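/- Let $M$ be a smooth manifold of dimension $n$ (Hausdorff, second countable, without boundary), let $S\to M$ be a smooth complex vector bundle of finite rank $k$ with a smooth Hermitian structure, that is, with an inner product $\langle\cdot,\cdot\rangle_{S_p}$ on each fibre $S_p$ such that $p\mapsto\langle u(p),v(p)\rangle_{S_p}$ is smooth for all smooth sections $u,v$ of $S$. Let $\mu$ be a nowhere vanishing smooth measure on $M$, that is, a Borel measure such that for every smooth chart $(U,\varphi)$ there is a smooth function $f\colon\varphi(U)\to(0,\infty)$ with $\mathrm d(\varphi_*(\mu|_U))=f\,\mathrm d\lambda|_{\varphi(U)}$, where $\lambda$ is Lebesgue measure. Write $\Gamma^\infty(M;S)$ and $\Gamma^\infty_c(M;S)$ for the spaces of smooth sections and of smooth compactly supported sections, and let $L^2(M;S)$ be the Hilbert space completion of $\Gamma_c^\infty(M;S)$ with respect to $\langle u,v\rangle=\int_M\langle u(p),v(p)\rangle_{S_p}\,\mathrm d\mu(p)$. For $K\subseteq M$ let $L^2(K;S)\subseteq L^2(M;S)$ be the closure of the space of smooth sections whose compact support is contained in $K$; an element of $L^2(M;S)$ is called compactly supported if it lies in $L^2(K;S)$ for some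 compact $K\subseteq M$. A (first order linear) differential operator is a $\mathbb C$-linear map $D\colon\Gamma^\infty(M;S)\to\Gamma^\infty(M;S)$ such that (a) if $u,v$ agree on an open set $U$, then so do $Du,Dv$; and (b) over every open set $U$ which is the domain of a smooth chart $\varphi$ and over which $S$ has a smooth local trivialization $\Psi=(\pi,\psi)\colon S|_U\to U\times\mathbb C^k$, there are smooth $A^1,\dots,A^n,B\colon U\to M_k(\mathbb C)$ such that for all $u\in\Gamma^\infty(M;S)$ and $p\in U$ $$\psi\bigl((Du)(p)\bigr)=\sum_{j=1}^n A^j(p)\,\partial_j(\psi\circ u\circ\varphi^{-1})|_{\varphi(p)}+B(p)\,\psi(u(p)).$$ Regard $D$ as an unbounded operator on $L^2(M;S)$ with dense domain $\Gamma_c^\infty(M;S)$, and assume that $D$ is symmetric, that is, $\langle Du,v\rangle=\langle u,Dv\rangle$ for all $u,v\in\Gamma_c^\infty(M;S)$. Let $\overline D$ be its closure and $D^*$ its adjoint. Then for every compactly supported $u\in L^2(M;S)$, $$u\in\operatorname{dom}\overline D\iff u\in\operatorname{dom}D^*.$$ In particular, if $M$ is compact, then $D$ is essentially self-adjoint, that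 is, $D$ is symmetric and $\operatorname{dom}\overline D=\operatorname{dom}D^*$. -/

import Mathlib

open Bundle MeasureTheory Set
open scoped Manifold ContDiff Topology ComplexConjugate LinearPMap

noncomputable section

namespace HermitianL2

/-! ### Complex vector bundles as real vector bundles

`M` is a manifold modelled on `ℝⁿ`, `F` is a finite-dimensional complex vector space (the model
fibre, `ℂᵏ` up to isomorphism) and `S` is a complex vector bundle over `M` with model fibre `F`,
each of whose fibres carries a Hermitian inner product.  Smoothness is smoothness over `ℝ`, so
the underlying real vector bundle is needed. -/

section RealStructure

variable {M : Type*} [TopologicalSpace M]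
  {F : Type*} [NormedAddCommGroup F] [NormedSpace ℂ F]
  {S : M → Type*} [TopologicalSpace (TotalSpace F S)]
  [∀ p, NormedAddCommGroup (S p)] [∀ p, InnerProductSpace ℂ (S p)]
  [FiberBundle F S] [VectorBundle ℂ F S]

/-- A complex vector bundle is a real vector bundle, with the same trivializations. -/
instance realVectorBundle : VectorBundle ℝ F S where
  trivialization_linear' e _ :=
    ⟨fun _ hb => ⟨(e.linear ℂ hb).1, fun c v => (e.linear ℂ hb).2 (c : ℂ) v⟩⟩
  continuousOn_coordChange' e e' _ _ := by
    have : e.IsLinear ℝ := ⟨fun _ hb => ⟨(e.linear ℂ hb).1, fun c v => (e.linear ℂ hb).2 (c : ℂ) v⟩⟩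
    have : e'.IsLinear ℝ :=
      ⟨fun _ hb => ⟨(e'.linear ℂ hb).1, fun c v => (e'.linear ℂ hb).2 (c : ℂ) v⟩⟩
    have h := (ContinuousLinearMap.restrictScalarsL ℂ F F ℝ ℝ).continuous.comp_continuousOn
      (continuousOn_coordChange ℂ e e')
    refine h.congr fun b hb => ?_
    ext y
    exact (Trivialization.coordChangeL_apply e e' hb y).trans
      (Trivialization.coordChangeL_apply (R := ℂ) e e' hb y).symm

end RealStructure

/-! ### Smooth measures -/

/-- A (nowhere vanishing) smooth measure: in every chart `φ` of the smooth structure its image is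
given by a smooth positive density `f` with respect to Lebesgue measure. -/
class IsSmoothMeasure (n : ℕ) {M : Type*} [TopologicalSpace M]
    [ChartedSpace (EuclideanSpace ℝ (Fin n)) M] [MeasurableSpace M] (μ : Measure M) : Prop where
  exists_density : ∀ φ ∈ IsManifold.maximalAtlas (𝓡 n) ∞ M,
    ∃ f : EuclideanSpace ℝ (Fin n) → ℝ, ContDiffOn ℝ ∞ f φ.target ∧ (∀ x ∈ φ.target, 0 < f x) ∧
      (μ.restrict φ.source).map φ =
        (volume.restrict φ.target).withDensity fun x => ENNReal.ofReal (f x)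

section Measure

variable (n : ℕ) {M : Type*} [TopologicalSpace M] [ChartedSpace (EuclideanSpace ℝ (Fin n)) M]
  [IsManifold (𝓡 n) ∞ M] [MeasurableSpace M] [BorelSpace M] (μ : Measure M)

theorem measure_eq_density [IsSmoothMeasure n μ] (x : M) : ∃ f : EuclideanSpace ℝ (Fin n) → ℝ,
    ContinuousOn f (chartAt (EuclideanSpace ℝ (Fin n)) x).target ∧
    (∀ y ∈ (chartAt (EuclideanSpace ℝ (Fin n)) x).target, 0 < f y) ∧
    ∀ W ⊆ (chartAt (EuclideanSpace ℝ (Fin n)) x).target, IsOpen W →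
      μ ((chartAt (EuclideanSpace ℝ (Fin n)) x).source ∩
        chartAt (EuclideanSpace ℝ (Fin n)) x ⁻¹' W) = ∫⁻ y in W, ENNReal.ofReal (f y) := by
  set φ := chartAt (EuclideanSpace ℝ (Fin n)) x
  obtain ⟨f, hf, hpos, hmap⟩ := IsSmoothMeasure.exists_density (n := n) (μ := μ) φ
    (IsManifold.chart_mem_maximalAtlas x)
  refine ⟨f, hf.continuousOn, hpos, fun W hWt hW => ?_⟩
  have hφ : AEMeasurable φ (μ.restrict φ.source) :=
    φ.continuousOn.aemeasurable φ.open_source.measurableSet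
  have h := congrArg (fun ν => ν W) hmap
  rw [Measure.map_apply_of_aemeasurable hφ hW.measurableSet,
    withDensity_apply _ hW.measurableSet, Measure.restrict_restrict hW.measurableSet,
    inter_eq_left.2 hWt, Measure.restrict_apply₀' φ.open_source.measurableSet.nullMeasurableSet,
    inter_comm] at h
  exact h

theorem isLocallyFiniteMeasure [IsSmoothMeasure n μ] : IsLocallyFiniteMeasure μ := by
  refine ⟨fun x => ?_⟩
  obtain ⟨f, hf, -, hμ⟩ := measure_eq_density n μ x
  set φ := chartAt (EuclideanSpace ℝ (Fin n)) x
  have hx : φ x ∈ φ.target := φ.map_source (mem_chart_source _ x)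
  have hc : ContinuousAt f (φ x) := hf.continuousAt (φ.open_target.mem_nhds hx)
  have hev : ∀ᶠ y in 𝓝 (φ x), f y < f (φ x) + 1 ∧ y ∈ φ.target :=
    (hc.eventually (gt_mem_nhds (lt_add_one _))).and (φ.open_target.mem_nhds hx)
  obtain ⟨r, hr, hball⟩ := Metric.eventually_nhds_iff_ball.1 hev
  refine ⟨φ.source ∩ φ ⁻¹' Metric.ball (φ x) r, ?_, ?_⟩
  · exact (φ.continuousOn.isOpen_inter_preimage φ.open_source Metric.isOpen_ball).mem_nhds
      ⟨mem_chart_source _ x, Metric.mem_ball_self hr⟩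
  · rw [hμ _ (fun y hy => (hball y hy).2) Metric.isOpen_ball]
    calc ∫⁻ y in Metric.ball (φ x) r, ENNReal.ofReal (f y)
        ≤ ∫⁻ _ in Metric.ball (φ x) r, ENNReal.ofReal (f (φ x) + 1) :=
          setLIntegral_mono measurable_const
            fun y hy => ENNReal.ofReal_le_ofReal (hball y hy).1.le
      _ = ENNReal.ofReal (f (φ x) + 1) * volume (Metric.ball (φ x) r) := setLIntegral_const _ _
      _ < ⊤ := ENNReal.mul_lt_top ENNReal.ofReal_lt_top measure_ball_lt_top

theorem isOpenPosMeasure [IsSmoothMeasure n μ] : μ.IsOpenPosMeasure := by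
  refine ⟨fun U hU ⟨x, hxU⟩ h0 => ?_⟩
  obtain ⟨f, hf, hpos, hμ⟩ := measure_eq_density n μ x
  set φ := chartAt (EuclideanSpace ℝ (Fin n)) x
  set W := φ.target ∩ φ.symm ⁻¹' U
  have hW : IsOpen W := φ.symm.continuousOn.isOpen_inter_preimage φ.open_target hU
  have hxW : φ x ∈ W := ⟨φ.map_source (mem_chart_source _ x), by
    simpa [φ.left_inv (mem_chart_source _ x)] using hxU⟩
  have hle : μ (φ.source ∩ φ ⁻¹' W) ≤ μ U := measure_mono fun y hy => by
    have := hy.2.2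
    rwa [mem_preimage, φ.left_inv hy.1] at this
  rw [h0, hμ W inter_subset_left hW, nonpos_iff_eq_zero,
    lintegral_eq_zero_iff' ((hf.mono inter_subset_left).aemeasurable
      hW.measurableSet).ennreal_ofReal] at hle
  have hne : volume.restrict W ≠ 0 := by
    rw [Ne, Measure.restrict_eq_zero]
    exact (hW.measure_pos _ ⟨_, hxW⟩).ne'
  have : (ae (volume.restrict W)).NeBot := ae_neBot.2 hne
  obtain ⟨y, hy0, hyW⟩ := (hle.and (ae_restrict_mem hW.measurableSet)).exists
  exact absurd (ENNReal.ofReal_eq_zero.1 hy0) (not_le.2 (hpos y hyW.1))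

end Measure

/-! ### Smooth sections -/

section Sections

variable (n : ℕ) {M : Type*} [TopologicalSpace M] [ChartedSpace (EuclideanSpace ℝ (Fin n)) M]
  (F : Type*) [NormedAddCommGroup F] [NormedSpace ℂ F]
  (S : M → Type*) [TopologicalSpace (TotalSpace F S)]
  [∀ p, NormedAddCommGroup (S p)] [∀ p, InnerProductSpace ℂ (S p)]
  [FiberBundle F S] [VectorBundle ℂ F S]

/-- The complex vector space `Γ^∞(M; S)` of smooth sections. -/
def smoothSections : Submodule ℂ (∀ p, S p) where
  carrier := {u | ContMDiff (𝓡 n) ((𝓡 n).prod 𝓘(ℝ, F)) ∞ fun p => TotalSpace.mk' F p (u p)}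
  zero_mem' := contMDiff_zeroSection ℝ S
  add_mem' hu hv := ContMDiff.add_section hu hv
  smul_mem' c u hu := by
    intro x₀
    have hs := hu x₀
    rw [contMDiffAt_section] at hs ⊢
    set e := trivializationAt F S x₀
    refine ((contDiff_const_smul c).contMDiff.contMDiffAt.comp x₀ hs).congr_of_eventuallyEq ?_
    filter_upwards [e.open_baseSet.mem_nhds (mem_baseSet_trivializationAt F S x₀)] with x hx
    exact (e.linear ℂ hx).2 c (u x)

variable {S} in
/-- The support of a section: the closure of the set of points where it does not vanish. -/
def sectionSupport (u : ∀ p, S p) : Set M := closure {p | u p ≠ 0}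

/-- The complex vector space `Γ_c^∞(M; S)` of smooth sections with compact support. -/
def testSections : Submodule ℂ (∀ p, S p) where
  carrier := {u | u ∈ smoothSections n F S ∧ IsCompact (sectionSupport u)}
  zero_mem' := ⟨zero_mem _, by simp [sectionSupport]⟩
  add_mem' {u v} hu hv := ⟨add_mem hu.1 hv.1, (hu.2.union hv.2).of_isClosed_subset isClosed_closure
    (by
      rw [sectionSupport, sectionSupport, sectionSupport, ← closure_union]
      refine closure_mono fun p hp => ?_
      by_contra hcon
      simp only [mem_union, mem_ofPred_eq, not_or, not_not] at hcon
      exact hp (by simp [hcon.1, hcon.2]))⟩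
  smul_mem' c u hu := ⟨Submodule.smul_mem _ c hu.1, hu.2.of_isClosed_subset isClosed_closure
    (closure_mono fun p hp h0 => hp (by simp [h0]))⟩

/-- The inner products of the fibres vary smoothly: `p ↦ ⟪u p, v p⟫` is smooth for all smooth
sections `u`, `v`.  Together with the smooth vector bundle structure this makes `S` a smooth
Hermitian vector bundle. -/
class IsSmoothHermitian : Prop where
  contMDiff_inner : ∀ u ∈ smoothSections n F S, ∀ v ∈ smoothSections n F S,
    ContMDiff (𝓡 n) 𝓘(ℝ, ℂ) ∞ fun p => inner ℂ (u p) (v p)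

/-- A first order linear differential operator acting on the sections of `S`. -/
structure DifferentialOperator where
  toLinearMap : smoothSections n F S →ₗ[ℂ] smoothSections n F S
  /-- If `u` and `v` agree on an open set `U`, then so do `D u` and `D v`. -/
  isLocal : ∀ (u v : smoothSections n F S) (U : Set M), IsOpen U →
    (∀ p ∈ U, u.1 p = v.1 p) → ∀ p ∈ U, (toLinearMap u).1 p = (toLinearMap v).1 p
  /-- On the common domain of a chart `φ` and a local trivialization `e`, whose second component is
  `ψ`, one has `ψ (D u) = ∑ j, A j • ∂ⱼ (ψ ∘ u ∘ φ⁻¹) + B • (ψ ∘ u)` with smooth coefficients. -/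
  exists_local_form : ∀ φ ∈ IsManifold.maximalAtlas (𝓡 n) ∞ M,
    ∀ (e : Trivialization F (π F S)) [MemTrivializationAtlas e],
    ∃ (A : Fin n → M → F →L[ℂ] F) (B : M → F →L[ℂ] F),
      (∀ j, ContMDiffOn (𝓡 n) 𝓘(ℝ, F →L[ℂ] F) ∞ (A j) (φ.source ∩ e.baseSet)) ∧
      ContMDiffOn (𝓡 n) 𝓘(ℝ, F →L[ℂ] F) ∞ B (φ.source ∩ e.baseSet) ∧
      ∀ p ∈ φ.source ∩ e.baseSet, ∀ u : smoothSections n F S,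
        (toLinearMap u).1 p =
          ∑ j, e.symm p (A j p (fderiv ℝ
            (fun x => (e (TotalSpace.mk' F (φ.symm x) (u.1 (φ.symm x)))).2) (φ p)
            (EuclideanSpace.single j 1)))
          + e.symm p (B p (e (TotalSpace.mk' F p (u.1 p))).2)

variable {n F S}

theorem DifferentialOperator.support_subset (D : DifferentialOperator n F S)
    (u : smoothSections n F S) : sectionSupport (D.toLinearMap u).1 ⊆ sectionSupport u.1 := by
  refine closure_minimal (fun p hp => ?_) isClosed_closure
  by_contra hps
  refine hp ?_
  have h := D.isLocal u 0 (sectionSupport u.1)ᶜ isClosed_closure.isOpen_compl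
    (fun q hq => by
      by_contra h
      exact hq (subset_closure h)) p hps
  simpa using h

/-- A differential operator maps `Γ_c^∞(M; S)` to itself. -/
def DifferentialOperator.onTestSections (D : DifferentialOperator n F S) :
    testSections n F S →ₗ[ℂ] testSections n F S where
  toFun u := ⟨(D.toLinearMap ⟨u.1, u.2.1⟩).1, (D.toLinearMap ⟨u.1, u.2.1⟩).2,
    u.2.2.of_isClosed_subset isClosed_closure (D.support_subset ⟨u.1, u.2.1⟩)⟩
  map_add' u v := Subtype.ext <|
    congrArg (fun w : smoothSections n F S => w.1) (map_add D.toLinearMap ⟨u.1, u.2.1⟩ ⟨v.1, v.2.1⟩)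
  map_smul' c u := Subtype.ext <|
    congrArg (fun w : smoothSections n F S => w.1) (map_smul D.toLinearMap c ⟨u.1, u.2.1⟩)

theorem continuous_inner_sections [IsSmoothHermitian n F S] (u v : testSections n F S) :
    Continuous fun p => inner ℂ (u.1 p) (v.1 p) :=
  (IsSmoothHermitian.contMDiff_inner (n := n) (F := F) u.1 u.2.1 v.1 v.2.1).continuous

end Sections

/-! ### The Hilbert space of square integrable sections -/

section L2

variable (n : ℕ) {M : Type*} [TopologicalSpace M]
  [ChartedSpace (EuclideanSpace ℝ (Fin n)) M] [MeasurableSpace M]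
  (F : Type*) [NormedAddCommGroup F] [NormedSpace ℂ F]
  (S : M → Type*) [TopologicalSpace (TotalSpace F S)]
  [∀ p, NormedAddCommGroup (S p)] [∀ p, InnerProductSpace ℂ (S p)]
  [FiberBundle F S] [VectorBundle ℂ F S]

/-- `Γ_c^∞(M; S)`, regarded as a pre-Hilbert space by means of the measure `μ`. -/
def PreL2 (_μ : Measure M) : Type _ := testSections n F S

variable (μ : Measure M)

instance : AddCommGroup (PreL2 n F S μ) := inferInstanceAs (AddCommGroup (testSections n F S))

instance : Module ℂ (PreL2 n F S μ) := inferInstanceAs (Module ℂ (testSections n F S))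

variable [IsManifold (𝓡 n) ∞ M] [BorelSpace M]
  [IsSmoothHermitian n F S] [IsSmoothMeasure n μ]

variable {n F S} in
theorem integrable_inner_sections (u v : testSections n F S) :
    Integrable (fun p => inner ℂ (u.1 p) (v.1 p)) μ := by
  have := isLocallyFiniteMeasure n μ
  refine (continuous_inner_sections u v).integrable_of_hasCompactSupport ?_
  refine u.2.2.of_isClosed_subset isClosed_closure (closure_mono fun p hp h0 => hp ?_)
  simp [h0]

/-- The inner product `⟪u, v⟫ = ∫ p, ⟪u p, v p⟫ ∂μ` on `Γ_c^∞(M; S)`. -/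
abbrev innerCore : InnerProductSpace.Core ℂ (PreL2 n F S μ) where
  inner u v := ∫ p, inner ℂ (u.1 p) (v.1 p) ∂μ
  conj_inner_symm u v := by
    rw [← integral_conj]
    simp only [inner_conj_symm]
  re_inner_nonneg u := by
    rw [← integral_re (integrable_inner_sections μ u u)]
    exact integral_nonneg fun p => inner_self_nonneg
  add_left u v w := by
    change ∫ p, inner ℂ (u.1 p + v.1 p) (w.1 p) ∂μ = _
    simp only [inner_add_left]
    exact integral_add (integrable_inner_sections μ u w) (integrable_inner_sections μ v w)
  smul_left u v c := by
    change ∫ p, inner ℂ (c • u.1 p) (v.1 p) ∂μ = _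
    simp only [inner_smul_left]
    exact integral_const_mul _ _
  definite u hu := by
    have := isOpenPosMeasure n μ
    have hu' : ∫ p, RCLike.re (inner ℂ (u.1 p) (u.1 p)) ∂μ = 0 := by
      rw [integral_re (integrable_inner_sections μ u u)]
      change RCLike.re (∫ p, inner ℂ (u.1 p) (u.1 p) ∂μ) = 0
      have : ∫ p, inner ℂ (u.1 p) (u.1 p) ∂μ = 0 := hu
      rw [this, map_zero]
    rw [integral_eq_zero_iff_of_nonneg (fun p => inner_self_nonneg)
      (integrable_inner_sections μ u u).re] at hu'
    have hc : Continuous fun p => RCLike.re (inner ℂ (u.1 p) (u.1 p)) :=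
      RCLike.continuous_re.comp (continuous_inner_sections u u)
    have h0 := (hc.ae_eq_iff_eq μ continuous_const).1 hu'
    refine Subtype.ext (funext fun p => ?_)
    exact re_inner_self_nonpos.1 (congrFun h0 p).le

instance : NormedAddCommGroup (PreL2 n F S μ) := (innerCore n F S μ).toNormedAddCommGroup

instance : InnerProductSpace ℂ (PreL2 n F S μ) :=
  InnerProductSpace.ofCore (innerCore n F S μ).toCore

theorem preL2_inner_def (u v : PreL2 n F S μ) :
    inner ℂ u v = ∫ p, inner ℂ (u.1 p) (v.1 p) ∂μ := rfl

/-- The Hilbert space `L²(M; S)`: the completion of `Γ_c^∞(M; S)`. -/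
abbrev L2 : Type _ := UniformSpace.Completion (PreL2 n F S μ)

/-- The inclusion of `Γ_c^∞(M; S)` into `L²(M; S)`. -/
def toL2 : testSections n F S →ₗ[ℂ] L2 n F S μ :=
  (UniformSpace.Completion.toComplₗᵢ (𝕜 := ℂ) (E := PreL2 n F S μ)).toLinearMap

theorem toL2_injective : Function.Injective (toL2 n F S μ) :=
  (UniformSpace.Completion.toComplₗᵢ (𝕜 := ℂ) (E := PreL2 n F S μ)).injective

variable {n F S μ}

/-- `u ∈ L²(M; S)` is compactly supported: for some compact `K ⊆ M` it lies in `L²(K; S)`, the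
closure in `L²(M; S)` of the space of the smooth sections whose compact support is contained
in `K`. -/
def L2.IsCompactlySupported (u : L2 n F S μ) : Prop :=
  ∃ K : Set M, IsCompact K ∧
    u ∈ closure (toL2 n F S μ '' {w : testSections n F S | sectionSupport w.1 ⊆ K})

variable (μ) in
/-- A differential operator as an unbounded operator on `L²(M; S)` with domain `Γ_c^∞(M; S)`. -/
def DifferentialOperator.toLinearPMap (D : DifferentialOperator n F S) :
    L2 n F S μ →ₗ.[ℂ] L2 n F S μ where
  domain := LinearMap.range (toL2 n F S μ)
  toFun := toL2 n F S μ ∘ₗ D.onTestSections ∘ₗ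
    (LinearEquiv.ofInjective (toL2 n F S μ) (toL2_injective n F S μ)).symm.toLinearMap

theorem DifferentialOperator.toLinearPMap_apply (D : DifferentialOperator n F S)
    (u : testSections n F S) :
    D.toLinearPMap μ ⟨toL2 n F S μ u, u, rfl⟩ = toL2 n F S μ (D.onTestSections u) := by
  have h : (LinearEquiv.ofInjective (toL2 n F S μ) (toL2_injective n F S μ)).symm
      ⟨toL2 n F S μ u, u, rfl⟩ = u :=
    (LinearEquiv.symm_apply_eq _).2 rfl
  exact congrArg (fun w => toL2 n F S μ (D.onTestSections w)) h

theorem DifferentialOperator.dense_domain (D : DifferentialOperator n F S) :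
    Dense ((D.toLinearPMap μ).domain : Set (L2 n F S μ)) :=
  UniformSpace.Completion.denseRange_coe (α := PreL2 n F S μ)

end L2

/-! ### Unbounded operators -/

section Unbounded

variable {H : Type*} [NormedAddCommGroup H] [InnerProductSpace ℂ H]

/-- `T` is symmetric: `⟪T x, y⟫ = ⟪x, T y⟫` for all `x`, `y` in the domain of `T`. -/
def IsSymmetricOp (T : H →ₗ.[ℂ] H) : Prop :=
  ∀ x y : T.domain, inner ℂ (T x) (y : H) = inner ℂ (x : H) (T y)

/-- `T` is essentially self-adjoint: it is symmetric and the domain of its closure is the domain of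
its adjoint. -/
def IsEssentiallySelfAdjointOp [CompleteSpace H] (T : H →ₗ.[ℂ] H) : Prop :=
  IsSymmetricOp T ∧ T.closure.domain = T†.domain

/-- A densely defined symmetric operator is closable, so that its closure is meaningful. -/
theorem IsSymmetricOp.isClosable [CompleteSpace H] {T : H →ₗ.[ℂ] H} (hT : IsSymmetricOp T)
    (hd : Dense (T.domain : Set H)) : T.IsClosable :=
  (LinearPMap.adjoint_isClosed hd).isClosable.leIsClosable
    (LinearPMap.IsFormalAdjoint.le_adjoint hd hT)

end Unbounded

end HermitianL2

end

noncomputable section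

namespace HermitianL2

/-! ### Unbounded operators: closures, adjoints and regularizing families -/

section Abstract

open Filter

variable {H : Type*} [NormedAddCommGroup H] [InnerProductSpace ℂ H]

/-! This is Friedrichs' mollifier argument. Since `D` is symmetric, its adjoint is a closed
extension, which gives one inclusion. For the other, let `u` be compactly supported in the domain of
the adjoint. One needs smoothing operators `J m` on test sections that are uniformly bounded, tend
strongly to the identity on sections supported in a fixed compact set, and have commutators with `D`
bounded uniformly in `m`. Then `J m u → u`, and `D J m u = J m D* u + [D, J m] u` stays bounded. By
weak compactness, here in the form of Hahn–Banach and Riesz, `u` lies in the domain of the double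
adjoint, which is that of the closure. This abstract part is `mem_closure_domain_of_regularizers`.

The operators come from a finite partition of unity. In one patch, with coordinates `ξ` and sections
`s a`, `t a` built from dual frames, `J ψ = ∑ a, (η_m * ⟪s a, ψ⟫) • t a`, where `*` is convolution
in the coordinates against `μ`. Writing `J` through scalar functions and global sections avoids
transporting sections to `ℝⁿ`, and the coefficients of `D` enter only through the commutators `[D,
g]`, which are pointwise and linear in the differential of `g` (`exists_symbol`, `comm_comp`).

In `[D, J]` the terms that do not differentiate `η_m` are harmless. The others contain `∂ⱼη_m`,
whose integral grows like `m`. Symmetry makes `[D, ξⱼ]` skew-Hermitian (`inner_commTest`), so these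
terms pair up as `d (∂ⱼη_m * g) - ∂ⱼη_m * (d g)`, with kernel `(d x - d y) ∂ⱼη_m(ξ x - ξ y)`
(`commutator_regularize`). Since `d` is Lipschitz, the kernel is dominated by `‖z‖ |∂ⱼη_m(z)|`,
whose integral does not depend on `m` (`lintegral_enorm_pderiv_scale`). The Schur test
(`lintegral_schur`) turns this into a uniform `L²` bound. -/

theorem norm_le_of_dense_inner {V : Type*} {i : V → H} (hi : DenseRange i) {y : H} {C : ℝ}
    (hC : 0 ≤ C) (h : ∀ x, ‖inner ℂ (i x) y‖ ≤ C * ‖i x‖) : ‖y‖ ≤ C := by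
  have h1 : ‖inner ℂ y y‖ ≤ C * ‖y‖ :=
    hi.induction_on (p := fun z => ‖inner ℂ z y‖ ≤ C * ‖z‖) y
      (isClosed_le (by fun_prop) (by fun_prop)) h
  rcases eq_or_ne y 0 with rfl | hy
  · simpa using hC
  · rw [norm_inner_eq_norm_iff hy hy |>.2 ⟨1, one_ne_zero, (one_smul _ _).symm⟩] at h1
    exact le_of_mul_le_mul_right h1 (norm_pos_iff.2 hy)

variable [CompleteSpace H] {T : H →ₗ.[ℂ] H}

/-- The double adjoint of a densely defined operator is contained in its closure. -/
theorem mem_topologicalClosure_graph (hd : Dense (T.domain : Set H)) {u w : H}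
    (h : ∀ v : T†.domain, inner ℂ (T† v) u = inner ℂ (v : H) w) :
    (u, w) ∈ T.graph.topologicalClosure := by
  -- The graph is viewed in the Hilbert sum, where closure is the double orthogonal complement. A
  -- pair `z` is orthogonal to the graph of `T` exactly when `T† z.snd = -z.fst`.
  set G : Submodule ℂ (WithLp 2 (H × H)) :=
    T.graph.map (WithLp.linearEquiv 2 ℂ (H × H)).symm.toLinearMap with hG
  have hmem : WithLp.toLp 2 (u, w) ∈ Gᗮᗮ := by
    rw [Submodule.mem_orthogonal]
    intro z hz
    rw [Submodule.mem_orthogonal] at hz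
    have hz' : ∀ x : T.domain, inner ℂ (x : H) z.fst + inner ℂ (T x) z.snd = 0 := fun x => by
      have := hz (WithLp.toLp 2 ((x : H), T x))
        (Submodule.mem_map_of_mem (f := (WithLp.linearEquiv 2 ℂ (H × H)).symm.toLinearMap)
          (T.mem_graph x))
      simpa [WithLp.prod_inner_apply] using this
    have hz2 : ∀ x : T.domain, inner ℂ (-z.fst) (x : H) = inner ℂ z.snd (T x) := fun x => by
      have := congrArg conj (hz' x)
      simp only [map_add, inner_conj_symm, map_zero] at this
      rw [inner_neg_left]
      linear_combination -this
    have hdom : z.snd ∈ T†.domain := LinearPMap.mem_adjoint_domain_of_exists _ ⟨_, hz2⟩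
    have hval : T† ⟨z.snd, hdom⟩ = -z.fst := LinearPMap.adjoint_apply_eq hd ⟨z.snd, hdom⟩ hz2
    have := h ⟨z.snd, hdom⟩
    rw [hval, inner_neg_left] at this
    simp only [WithLp.prod_inner_apply]
    change inner ℂ z.fst u + inner ℂ z.snd w = 0
    rw [← this]
    ring
  rw [Submodule.orthogonal_orthogonal_eq_closure] at hmem
  have hcont : Continuous (WithLp.ofLp : WithLp 2 (H × H) → H × H) :=
    WithLp.prod_continuous_ofLp 2 H H
  refine map_mem_closure (f := WithLp.ofLp) (x := WithLp.toLp 2 (u, w)) hcont hmem ?_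
  rintro _ ⟨x, hx, rfl⟩
  exact hx

/-- If `u` is the limit of elements of the domain of the closure of `T` with bounded images, then
`u` belongs to the domain of the closure. -/
theorem mem_closure_domain_of_bounded (hd : Dense (T.domain : Set H)) (hc : T.IsClosable)
    {u : H} {x y : ℕ → H} {C : ℝ}
    (hx : Tendsto x atTop (𝓝 u)) (hy : ∀ m, ‖y m‖ ≤ C)
    (hxy : ∀ m, (x m, y m) ∈ T.graph.topologicalClosure) : u ∈ T.closure.domain := by
  have hpair : ∀ m (v : T†.domain), inner ℂ (x m) (T† v) = inner ℂ (y m) (v : H) := by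
    intro m v
    have hcl : IsClosed {z : H × H | inner ℂ z.1 (T† v) = inner ℂ z.2 (v : H)} :=
      isClosed_eq (by fun_prop) (by fun_prop)
    refine closure_minimal ?_ hcl (hxy m)
    rintro z hz
    obtain ⟨z', hz1, hz2⟩ := (LinearPMap.mem_graph_iff _).1 hz
    change inner ℂ z.1 (T† v) = inner ℂ z.2 (v : H)
    rw [← hz1, ← hz2]
    exact ((LinearPMap.adjoint_isFormalAdjoint hd).symm z' v).symm
  let ℓ : T†.domain →ₗ[ℂ] ℂ := (innerₛₗ ℂ u).comp T†.toFun
  have hℓ : ∀ v, ‖ℓ v‖ ≤ C * ‖v‖ := by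
    intro v
    have h1 : Tendsto (fun m => inner ℂ (x m) (T† v)) atTop (𝓝 (inner ℂ u (T† v))) :=
      hx.inner tendsto_const_nhds
    refine le_of_tendsto h1.norm (Eventually.of_forall fun m => ?_)
    rw [hpair]
    exact (norm_inner_le_norm _ _).trans (mul_le_mul_of_nonneg_right (hy m) (norm_nonneg _))
  -- The functional `⟪u, T† ·⟫` is bounded on the domain of `T†`. Its extension, represented by a
  -- vector `w`, replaces a weak limit of `y`.
  obtain ⟨g, hg, -⟩ := exists_extension_norm_eq T†.domain (ℓ.mkContinuous C hℓ)
  set w := (InnerProductSpace.toDual ℂ H).symm g with hw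
  have hmem : (u, w) ∈ T.graph.topologicalClosure := by
    refine mem_topologicalClosure_graph hd fun v => ?_
    have h2 : inner ℂ w (v : H) = inner ℂ u (T† v) := by
      rw [hw, InnerProductSpace.toDual_symm_apply, hg]
      rfl
    rw [← inner_conj_symm, ← h2, inner_conj_symm]
  rw [hc.graph_closure_eq_closure_graph] at hmem
  exact LinearPMap.mem_domain_of_mem_graph hmem

/-- Friedrichs' criterion: an element `u` of the domain of the adjoint of a symmetric operator
belongs to the domain of its closure if it can be approximated by means of regularizing operators
`J m` whose commutators with the operator are uniformly bounded. -/
theorem mem_closure_domain_of_regularizers {V : Type*} [NormedAddCommGroup V]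
    [InnerProductSpace ℂ V] (i : V →ₗᵢ[ℂ] H) (hi : DenseRange i) (D : V →ₗ[ℂ] V)
    (hD : ∀ x y, inner ℂ (D x) y = inner ℂ x (D y))
    (hd : Dense (T.domain : Set H)) (hc : T.IsClosable)
    (hT : ∀ x, (i x, i (D x)) ∈ T.graph)
    (J K : ℕ → V →ₗ[ℂ] V) (hJK : ∀ m x y, inner ℂ x (J m y) = inner ℂ (K m x) y) {C : ℝ}
    (hJ : ∀ m x, ‖J m x‖ ≤ C * ‖x‖) (hDJ : ∀ m, ∃ C', ∀ x, ‖D (J m x)‖ ≤ C' * ‖x‖)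
    (hcomm : ∀ m x, ‖D (J m x) - J m (D x)‖ ≤ C * ‖x‖)
    {W : Set V} (hW : ∀ w ∈ W, Tendsto (fun m => J m w) atTop (𝓝 w)) {u : H}
    (hu : u ∈ closure (i '' W)) (hu' : u ∈ T†.domain) : u ∈ T.closure.domain := by
  -- A negative `C` forces `V` to be zero, and then `0` serves as well.
  wlog hC : 0 ≤ C generalizing C
  · have hz : ∀ x : V, ‖x‖ = 0 := fun x => by
      refine le_antisymm ?_ (norm_nonneg _)
      by_contra! h
      nlinarith [hJ 0 x, norm_nonneg (J 0 x)]
    refine this (C := 0) (fun m x => ?_) (fun m x => ?_) le_rfl <;> simp [hz]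
  have hiL : DenseRange i.toLinearMap := hi
  -- `A m` and `B m` are the continuous extensions of `J m` and `D ∘ J m` to `H`, needed because `u`
  -- is not in the image of `V`.
  let A : ℕ → H →L[ℂ] H := fun m => (i.toLinearMap ∘ₗ J m).extendOfNorm i.toLinearMap
  let B : ℕ → H →L[ℂ] H := fun m => (i.toLinearMap ∘ₗ D ∘ₗ J m).extendOfNorm i.toLinearMap
  have hJ' : ∀ m x, ‖(i.toLinearMap ∘ₗ J m) x‖ ≤ C * ‖i.toLinearMap x‖ := fun m x => by
    simpa using hJ m x
  have hA : ∀ m x, A m (i x) = i (J m x) := fun m x =>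
    LinearMap.extendOfNorm_eq hiL ⟨C, hJ' m⟩ x
  have hAn : ∀ m z, ‖A m z‖ ≤ C * ‖z‖ := fun m z =>
    LinearMap.norm_extendOfNorm_apply_le hiL C (hJ' m) z
  have hB : ∀ m x, B m (i x) = i (D (J m x)) := fun m x => by
    obtain ⟨C', hC'⟩ := hDJ m
    exact LinearMap.extendOfNorm_eq hiL ⟨C', fun x => by simpa using hC' x⟩ x
  -- the adjoints `K m` satisfy the same estimates
  have hK : ∀ m x, ‖K m x‖ ≤ C * ‖x‖ := fun m x => by
    have h1 : ‖inner ℂ (K m x) (K m x)‖ ≤ ‖x‖ * (C * ‖K m x‖) := by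
      rw [← hJK]
      exact (norm_inner_le_norm _ _).trans (mul_le_mul_of_nonneg_left (hJ m _) (norm_nonneg _))
    rcases eq_or_ne (K m x) 0 with h0 | h0
    · rw [h0, norm_zero]; positivity
    · rw [norm_inner_eq_norm_iff h0 h0 |>.2 ⟨1, one_ne_zero, (one_smul _ _).symm⟩] at h1
      refine le_of_mul_le_mul_right (h1.trans_eq ?_) (norm_pos_iff.2 h0)
      ring
  have hK' : ∀ m x, ‖D (K m x) - K m (D x)‖ ≤ C * ‖x‖ := fun m x => by
    set z := D (K m x) - K m (D x) with hz
    have h1 : ‖inner ℂ z z‖ ≤ ‖x‖ * (C * ‖z‖) := by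
      have : inner ℂ z z = -inner ℂ x (D (J m z) - J m (D z)) := by
        nth_rewrite 1 [hz]
        rw [inner_sub_left, hD, ← hJK, ← hJK, hD, inner_sub_right]
        ring
      rw [this, norm_neg]
      exact (norm_inner_le_norm _ _).trans (mul_le_mul_of_nonneg_left (hcomm m _) (norm_nonneg _))
    rcases eq_or_ne z 0 with h0 | h0
    · rw [h0, norm_zero]; positivity
    · rw [norm_inner_eq_norm_iff h0 h0 |>.2 ⟨1, one_ne_zero, (one_smul _ _).symm⟩] at h1
      refine le_of_mul_le_mul_right (h1.trans_eq ?_) (norm_pos_iff.2 h0)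
      ring
  have hlim : Tendsto (fun m => A m u) atTop (𝓝 u) := by
    rw [Metric.tendsto_atTop]
    intro ε hε
    obtain ⟨_, ⟨w, hw, rfl⟩, hwu⟩ := Metric.mem_closure_iff.1 hu (ε / (2 * (C + 1))) (by positivity)
    obtain ⟨N, hN⟩ := Metric.tendsto_atTop.1 (hW w hw) (ε / 2) (by positivity)
    refine ⟨N, fun m hm => ?_⟩
    have h1 := hN m hm
    rw [dist_eq_norm] at h1 hwu ⊢
    have h2 : A m u - u = A m (u - i w) + i (J m w - w) - (u - i w) := by
      rw [map_sub, hA, map_sub]; abel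
    have h3 : ‖i (J m w - w)‖ < ε / 2 := by rwa [i.norm_map]
    have h4 : ‖u - i w‖ * (C + 1) < ε / 2 := by
      rw [lt_div_iff₀ (by positivity)] at hwu
      linarith
    calc ‖A m u - u‖ ≤ ‖A m (u - i w)‖ + ‖i (J m w - w)‖ + ‖u - i w‖ := by
          rw [h2]
          exact (norm_sub_le _ _).trans (add_le_add_left (norm_add_le _ _) _)
      _ < ε := by linarith [hAn m (u - i w)]
  set u' := T† ⟨u, hu'⟩ with hu'_def
  refine mem_closure_domain_of_bounded (y := fun m => B m u) (C := C * ‖u'‖ + C * ‖u‖) hd hc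
    hlim (fun m => ?_) fun m => ?_
  · refine norm_le_of_dense_inner hi (by positivity) fun x => ?_
    -- `D ∘ J m` is transposed onto the test vector, so that `u` itself is never differentiated.
    have h1 : inner ℂ (i x) (B m u) = inner ℂ (i (K m (D x))) u := by
      refine hi.induction_on (p := fun z => inner ℂ (i x) (B m z) = inner ℂ (i (K m (D x))) z) u
        (isClosed_eq (by fun_prop) (by fun_prop)) fun y => ?_
      rw [hB, i.inner_map_map, i.inner_map_map, ← hD, hJK]
    -- This is where `u ∈ dom T†` enters. What remains is the commutator of `D` with `K m`, which is
    -- minus the formal adjoint of that with `J m`.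
    have h2 : inner ℂ (i (D (K m x))) u = inner ℂ (i (K m x)) u' := by
      obtain ⟨z, hz1, hz2⟩ := (LinearPMap.mem_graph_iff _).1 (hT (K m x))
      have := (LinearPMap.adjoint_isFormalAdjoint hd).symm z ⟨u, hu'⟩
      rwa [hz1, hz2] at this
    have h3 : inner ℂ (i x) (B m u) =
        inner ℂ (i (K m x)) u' - inner ℂ (i (D (K m x) - K m (D x))) u := by
      rw [h1, ← h2, map_sub, inner_sub_left]
      ring
    rw [h3]
    refine (norm_sub_le _ _).trans ?_
    have h4 := norm_inner_le_norm (𝕜 := ℂ) (i (K m x)) u'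
    have h5 := norm_inner_le_norm (𝕜 := ℂ) (i (D (K m x) - K m (D x))) u
    rw [i.norm_map] at h4 h5 ⊢
    have h6 := mul_le_mul_of_nonneg_right (hK m x) (norm_nonneg u')
    have h7 := mul_le_mul_of_nonneg_right (hK' m x) (norm_nonneg u)
    linarith
  -- On the dense image of `V` the pair is `(J m x, D (J m x))`, which lies in the graph. Continuity
  -- of `A m` and `B m` extends this to `u`.
  · have hcl : IsClosed {z : H | (A m z, B m z) ∈ T.graph.topologicalClosure} :=
      T.graph.isClosed_topologicalClosure.preimage (by fun_prop)
    refine hi.induction_on (p := fun z => (A m z, B m z) ∈ T.graph.topologicalClosure) u hcl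
      fun x => ?_
    rw [hA, hB]
    exact T.graph.le_topologicalClosure (hT _)

end Abstract

/-! ### Commutators of differential operators with smooth functions -/

section Commutator

variable {n : ℕ} {M : Type*} [TopologicalSpace M] [ChartedSpace (EuclideanSpace ℝ (Fin n)) M]
  {F : Type*} [NormedAddCommGroup F] [NormedSpace ℂ F]
  {S : M → Type*} [TopologicalSpace (TotalSpace F S)]
  [∀ p, NormedAddCommGroup (S p)] [∀ p, InnerProductSpace ℂ (S p)]
  [FiberBundle F S] [VectorBundle ℂ F S]

/-- The product of a smooth function and a smooth section. -/
def mulSection (g : C^∞⟮𝓡 n, M; 𝓘(ℝ, ℂ), ℂ⟯) (u : smoothSections n F S) : smoothSections n F S :=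
  ⟨fun p => g p • u.1 p, by
    intro x₀
    have hs := u.2 x₀
    rw [contMDiffAt_section] at hs ⊢
    set e := trivializationAt F S x₀
    have hsm : ContDiff ℝ ∞ fun q : ℂ × F => q.1 • q.2 := isBoundedBilinearMap_smul.contDiff
    refine (hsm.contMDiff.contMDiffAt.comp x₀
      ((g.contMDiff x₀).prodMk_space hs)).congr_of_eventuallyEq ?_
    filter_upwards [e.open_baseSet.mem_nhds (mem_baseSet_trivializationAt F S x₀)] with x hx
    exact (e.linear ℂ hx).2 (g x) (u.1 x)⟩

@[simp]
theorem mulSection_apply (g : C^∞⟮𝓡 n, M; 𝓘(ℝ, ℂ), ℂ⟯) (u : smoothSections n F S) (p : M) :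
    (mulSection g u).1 p = g p • u.1 p := rfl

/-- The commutator of a differential operator and the multiplication by a smooth function. -/
def DifferentialOperator.comm (D : DifferentialOperator n F S) (g : C^∞⟮𝓡 n, M; 𝓘(ℝ, ℂ), ℂ⟯)
    (u : smoothSections n F S) : smoothSections n F S :=
  D.toLinearMap (mulSection g u) - mulSection g (D.toLinearMap u)

theorem DifferentialOperator.apply_mulSection (D : DifferentialOperator n F S)
    (g : C^∞⟮𝓡 n, M; 𝓘(ℝ, ℂ), ℂ⟯) (u : smoothSections n F S) (p : M) :
    (D.toLinearMap (mulSection g u)).1 p = g p • (D.toLinearMap u).1 p + (D.comm g u).1 p := by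
  simp [comm]

variable [IsManifold (𝓡 n) ∞ M]

theorem differentiableAt_comp_chart_symm {V : Type*} [NormedAddCommGroup V] [NormedSpace ℝ V]
    {g : M → V} {p : M} (hg : ContMDiffAt (𝓡 n) 𝓘(ℝ, V) ∞ g p) :
    DifferentiableAt ℝ (g ∘ (chartAt (EuclideanSpace ℝ (Fin n)) p).symm)
      (chartAt (EuclideanSpace ℝ (Fin n)) p p) := by
  have h1 : ContMDiffAt (𝓡 n) 𝓘(ℝ, V) ∞ (g ∘ (chartAt (EuclideanSpace ℝ (Fin n)) p).symm)
      (chartAt (EuclideanSpace ℝ (Fin n)) p p) := by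
    refine ContMDiffAt.comp _ ?_
      (contMDiffOn_chart_symm.contMDiffAt ((chartAt _ p).open_target.mem_nhds
        (mem_chart_target _ p)))
    rwa [(chartAt _ p).left_inv (mem_chart_source _ p)]
  exact h1.contDiffAt.differentiableAt (by simp)

/-- The principal symbol: the commutator of a differential operator and a function is
of order zero and depends linearly on the differential of the function. -/
theorem DifferentialOperator.exists_symbol (D : DifferentialOperator n F S) (p : M) :
    ∃ a : Fin n → S p →ₗ[ℂ] S p, ∀ (g : C^∞⟮𝓡 n, M; 𝓘(ℝ, ℂ), ℂ⟯) (u : smoothSections n F S),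
      (D.comm g u).1 p = ∑ j, fderiv ℝ (g ∘ (chartAt (EuclideanSpace ℝ (Fin n)) p).symm)
        (chartAt (EuclideanSpace ℝ (Fin n)) p p) (EuclideanSpace.single j 1) • a j (u.1 p) := by
  set φ := chartAt (EuclideanSpace ℝ (Fin n)) p
  set e := trivializationAt F S p with he
  have hpφ : p ∈ φ.source := mem_chart_source _ p
  have hpe : p ∈ e.baseSet := mem_baseSet_trivializationAt F S p
  obtain ⟨A, B, -, -, h⟩ := D.exists_local_form φ (IsManifold.chart_mem_maximalAtlas p) e
  refine ⟨fun j => e.symmₗ ℂ p ∘ₗ (A j p).toLinearMap ∘ₗ e.linearMapAt ℂ p, fun g u => ?_⟩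
  have hu : DifferentiableAt ℝ ((fun x => (e (TotalSpace.mk' F x (u.1 x))).2) ∘ φ.symm) (φ p) :=
    differentiableAt_comp_chart_symm ((contMDiffAt_section _).1 (u.2 p))
  have hg : DifferentiableAt ℝ (g ∘ φ.symm) (φ p) := differentiableAt_comp_chart_symm (g.contMDiff p)
  have hev : (fun x => (e (TotalSpace.mk' F (φ.symm x) ((mulSection g u).1 (φ.symm x)))).2)
      =ᶠ[𝓝 (φ p)] fun x => (g ∘ φ.symm) x •
        ((fun x => (e (TotalSpace.mk' F x (u.1 x))).2) ∘ φ.symm) x := by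
    have hc : ContinuousAt φ.symm (φ p) := φ.continuousAt_symm (φ.map_source hpφ)
    have hnhds : e.baseSet ∈ 𝓝 (φ.symm (φ p)) := by
      rw [φ.left_inv hpφ]
      exact e.open_baseSet.mem_nhds hpe
    filter_upwards [hc hnhds] with x hx
    exact (e.linear ℂ hx).2 (g (φ.symm x)) (u.1 (φ.symm x))
  have hlin : (e (TotalSpace.mk' F p ((mulSection g u).1 p))).2 =
      g p • (e (TotalSpace.mk' F p (u.1 p))).2 := (e.linear ℂ hpe).2 (g p) (u.1 p)
  have hsymm : ∀ v, e.symm p v = e.symmₗ ℂ p v := fun v => by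
    rw [Trivialization.coe_symmₗ (R := ℂ) e hpe]
  have h1 := h p ⟨hpφ, hpe⟩ (mulSection g u)
  have h2 := h p ⟨hpφ, hpe⟩ u
  have hval : ((fun x => (e (TotalSpace.mk' F x (u.1 x))).2) ∘ φ.symm) (φ p) =
      (e (TotalSpace.mk' F p (u.1 p))).2 :=
    congrArg (fun x => (e (TotalSpace.mk' F x (u.1 x))).2) (φ.left_inv hpφ)
  -- By the product rule, the terms in which `g` is not differentiated, including the one with `B`,
  -- cancel against `g p • D u`.
  rw [hev.fderiv_eq, fderiv_fun_smul hg hu, hlin, hval] at h1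
  rw [comm]
  change (D.toLinearMap (mulSection g u)).1 p - g p • (D.toLinearMap u).1 p = _
  rw [h1, h2, sub_eq_iff_eq_add, smul_add, Finset.smul_sum, ← add_assoc, ← Finset.sum_add_distrib]
  simp only [hsymm, map_smul]
  congr 1
  refine Finset.sum_congr rfl fun j _ => ?_
  simp only [add_apply, smul_apply,
    ContinuousLinearMap.smulRight_apply, Function.comp_apply, φ.left_inv hpφ, map_add, map_smul,
    LinearMap.comp_apply, ContinuousLinearMap.coe_coe, e.linearMapAt_apply, hpe, if_true]
  rw [add_comm]
  rfl

/-- The commutator with a function acts pointwise. -/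
theorem DifferentialOperator.exists_comm_eq (D : DifferentialOperator n F S)
    (g : C^∞⟮𝓡 n, M; 𝓘(ℝ, ℂ), ℂ⟯) (p : M) :
    ∃ a : S p →ₗ[ℂ] S p, ∀ u, (D.comm g u).1 p = a (u.1 p) := by
  obtain ⟨a, ha⟩ := D.exists_symbol p
  exact ⟨∑ j, fderiv ℝ (g ∘ (chartAt (EuclideanSpace ℝ (Fin n)) p).symm)
        (chartAt (EuclideanSpace ℝ (Fin n)) p p) (EuclideanSpace.single j 1) • a j,
    fun u => by simp [ha g u, LinearMap.sum_apply]⟩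

theorem DifferentialOperator.comm_mulSection (D : DifferentialOperator n F S)
    (g h : C^∞⟮𝓡 n, M; 𝓘(ℝ, ℂ), ℂ⟯) (u : smoothSections n F S) (p : M) :
    (D.comm g (mulSection h u)).1 p = h p • (D.comm g u).1 p := by
  obtain ⟨a, ha⟩ := D.exists_comm_eq g p
  rw [ha, ha, mulSection_apply, map_smul]

/-- The complex-valued coordinates of a smooth map to a Euclidean space. -/
def coordFn (ξ : C^∞⟮𝓡 n, M; 𝓘(ℝ, EuclideanSpace ℝ (Fin n)), EuclideanSpace ℝ (Fin n)⟯)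
    (j : Fin n) : C^∞⟮𝓡 n, M; 𝓘(ℝ, ℂ), ℂ⟯ :=
  ⟨fun p => (ξ p j : ℂ), by
    have : ContDiff ℝ ∞ fun z : EuclideanSpace ℝ (Fin n) => (z j : ℂ) :=
      Complex.ofRealCLM.contDiff.comp (EuclideanSpace.proj j : _ →L[ℝ] ℝ).contDiff
    exact this.contMDiff.comp ξ.contMDiff⟩

/-- The chain rule for commutators. -/
theorem DifferentialOperator.comm_comp (D : DifferentialOperator n F S)
    (ξ : C^∞⟮𝓡 n, M; 𝓘(ℝ, EuclideanSpace ℝ (Fin n)), EuclideanSpace ℝ (Fin n)⟯)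
    {h : EuclideanSpace ℝ (Fin n) → ℂ} (hh : ContDiff ℝ ∞ h) (g : C^∞⟮𝓡 n, M; 𝓘(ℝ, ℂ), ℂ⟯)
    (hg : ∀ p, g p = h (ξ p)) (u : smoothSections n F S) (p : M) :
    (D.comm g u).1 p =
      ∑ j, fderiv ℝ h (ξ p) (EuclideanSpace.single j 1) • (D.comm (coordFn ξ j) u).1 p := by
  obtain ⟨a, ha⟩ := D.exists_symbol p
  set φ := chartAt (EuclideanSpace ℝ (Fin n)) p
  have hpφ : p ∈ φ.source := mem_chart_source _ p
  have hξ : DifferentiableAt ℝ (ξ ∘ φ.symm) (φ p) :=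
    differentiableAt_comp_chart_symm (ξ.contMDiff p)
  have hξj : ∀ j v, fderiv ℝ (coordFn ξ j ∘ φ.symm) (φ p) v =
      ((fderiv ℝ (ξ ∘ φ.symm) (φ p) v j : ℝ) : ℂ) := fun j v => by
    have h1 := ((Complex.ofRealCLM ∘L (EuclideanSpace.proj j : _ →L[ℝ] ℝ)).hasFDerivAt
      (x := (ξ ∘ φ.symm) (φ p))).comp (φ p) hξ.hasFDerivAt
    have h2 : coordFn ξ j ∘ φ.symm =
      (Complex.ofRealCLM ∘L (EuclideanSpace.proj j : _ →L[ℝ] ℝ)) ∘ (ξ ∘ φ.symm) := rfl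
    rw [h2, h1.fderiv]
    rfl
  have hgd : ∀ v, fderiv ℝ (g ∘ φ.symm) (φ p) v =
      ∑ j, fderiv ℝ h (ξ p) (EuclideanSpace.single j 1) *
        fderiv ℝ (coordFn ξ j ∘ φ.symm) (φ p) v := fun v => by
    have h2 : g ∘ φ.symm = h ∘ (ξ ∘ φ.symm) := funext fun x => hg _
    have h1 := ((hh.differentiable (by simp)).differentiableAt
      (x := (ξ ∘ φ.symm) (φ p))).hasFDerivAt.comp (φ p) hξ.hasFDerivAt
    rw [h2, h1.fderiv]
    simp only [ContinuousLinearMap.comp_apply, Function.comp_apply, φ.left_inv hpφ, hξj]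
    set w := fderiv ℝ (ξ ∘ φ.symm) (φ p) v
    have hw : w = ∑ j, w j • EuclideanSpace.single j (1 : ℝ) := by
      ext i
      simp [Finset.sum_apply, Pi.single_apply]
    conv_lhs => rw [hw]
    simp only [map_sum, map_smul]
    exact Finset.sum_congr rfl fun j _ => by rw [mul_comm, Complex.real_smul]
  simp only [ha, hgd, Finset.sum_smul, Finset.smul_sum, mul_smul]
  exact Finset.sum_comm

end Commutator

/-! ### Test sections and the symmetry of the operator -/

section TestSections

variable {n : ℕ} {M : Type*} [TopologicalSpace M] [ChartedSpace (EuclideanSpace ℝ (Fin n)) M]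
  {F : Type*} [NormedAddCommGroup F] [NormedSpace ℂ F]
  {S : M → Type*} [TopologicalSpace (TotalSpace F S)]
  [∀ p, NormedAddCommGroup (S p)] [∀ p, InnerProductSpace ℂ (S p)]
  [FiberBundle F S] [VectorBundle ℂ F S]

/-- The inclusion of the smooth sections with compact support into the smooth sections. -/
def toSmooth (u : testSections n F S) : smoothSections n F S := ⟨u.1, u.2.1⟩

/-- The product of a smooth function and a smooth section with compact support. -/
def mulTest (g : C^∞⟮𝓡 n, M; 𝓘(ℝ, ℂ), ℂ⟯) (u : testSections n F S) : testSections n F S :=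
  ⟨(mulSection g (toSmooth u)).1, (mulSection g (toSmooth u)).2,
    u.2.2.of_isClosed_subset isClosed_closure
      (closure_mono fun p hp h0 => hp (by simp [toSmooth, h0]))⟩

@[simp]
theorem mulTest_apply (g : C^∞⟮𝓡 n, M; 𝓘(ℝ, ℂ), ℂ⟯) (u : testSections n F S) (p : M) :
    (mulTest g u).1 p = g p • u.1 p := rfl

/-- The commutator with a smooth function, on the sections with compact support. -/
def DifferentialOperator.commTest (D : DifferentialOperator n F S)
    (g : C^∞⟮𝓡 n, M; 𝓘(ℝ, ℂ), ℂ⟯) (u : testSections n F S) : testSections n F S :=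
  D.onTestSections (mulTest g u) - mulTest g (D.onTestSections u)

theorem DifferentialOperator.commTest_apply (D : DifferentialOperator n F S)
    (g : C^∞⟮𝓡 n, M; 𝓘(ℝ, ℂ), ℂ⟯) (u : testSections n F S) (p : M) :
    (D.commTest g u).1 p = (D.comm g (toSmooth u)).1 p := rfl

theorem DifferentialOperator.onTestSections_mulTest (D : DifferentialOperator n F S)
    (g : C^∞⟮𝓡 n, M; 𝓘(ℝ, ℂ), ℂ⟯) (u : testSections n F S) (p : M) :
    (D.onTestSections (mulTest g u)).1 p =
      g p • (D.onTestSections u).1 p + (D.commTest g u).1 p :=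
  D.apply_mulSection g (toSmooth u) p

theorem DifferentialOperator.onTestSections_eq_zero (D : DifferentialOperator n F S)
    {K : Set M} (hK : IsClosed K) {u : testSections n F S} (hu : ∀ p ∉ K, u.1 p = 0) {p : M}
    (hp : p ∉ K) : (D.onTestSections u).1 p = 0 := by
  have h := D.isLocal (toSmooth u) 0 Kᶜ hK.isOpen_compl (fun q hq => hu q hq) p hp
  rw [map_zero] at h
  exact h

theorem DifferentialOperator.commTest_eq_zero [IsManifold (𝓡 n) ∞ M]
    (D : DifferentialOperator n F S) (g : C^∞⟮𝓡 n, M; 𝓘(ℝ, ℂ), ℂ⟯) {u : testSections n F S}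
    {p : M} (hp : u.1 p = 0) : (D.commTest g u).1 p = 0 := by
  obtain ⟨a, ha⟩ := D.exists_comm_eq g p
  rw [D.commTest_apply, ha]
  exact (congrArg a hp).trans (map_zero a)

theorem coe_sum_testSections {ι : Type*} (s : Finset ι) (u : ι → testSections n F S) (p : M) :
    (∑ a ∈ s, u a).1 p = ∑ a ∈ s, (u a).1 p := by
  rw [AddSubmonoidClass.coe_finsetSum, Finset.sum_apply]

theorem hasCompactSupport_inner_left (u : testSections n F S) (v : ∀ p, S p) :
    HasCompactSupport fun p => inner ℂ (u.1 p) (v p) :=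
  u.2.2.of_isClosed_subset isClosed_closure (closure_mono fun p hp h0 => hp (by simp [h0]))

variable [IsManifold (𝓡 n) ∞ M] [IsSmoothHermitian n F S]
  [MeasurableSpace M] [BorelSpace M] (μ : Measure M) [IsSmoothMeasure n μ]

/-- The symmetry of a differential operator, in terms of the integrals. -/
def DifferentialOperator.IsFormallySymmetric (D : DifferentialOperator n F S) : Prop :=
  ∀ u v : testSections n F S, ∫ p, inner ℂ ((D.onTestSections u).1 p) (v.1 p) ∂μ =
    ∫ p, inner ℂ (u.1 p) ((D.onTestSections v).1 p) ∂μ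

variable {μ}

theorem integrable_mul_inner {g : M → ℂ} (hg : Continuous g) (u v : testSections n F S) :
    Integrable (fun p => g p * inner ℂ (u.1 p) (v.1 p)) μ := by
  have := isLocallyFiniteMeasure n μ
  exact (hg.mul (continuous_inner_sections u v)).integrable_of_hasCompactSupport
    (hasCompactSupport_inner_left u v.1).mul_left

/-- The principal symbol of a symmetric operator is skew-Hermitian. -/
theorem DifferentialOperator.inner_commTest [T2Space M] [SecondCountableTopology M]
    {D : DifferentialOperator n F S} (hD : D.IsFormallySymmetric μ)
    {g : C^∞⟮𝓡 n, M; 𝓘(ℝ, ℂ), ℂ⟯} (hg : ∀ p, conj (g p) = g p) (u v : testSections n F S) (p : M) :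
    inner ℂ ((D.commTest g u).1 p) (v.1 p) = -inner ℂ (u.1 p) ((D.commTest g v).1 p) := by
  have := isLocallyFiniteMeasure n μ
  have := isOpenPosMeasure n μ
  have : LocallyCompactSpace M := ChartedSpace.locallyCompactSpace (EuclideanSpace ℝ (Fin n)) M
  set f : M → ℂ := fun p =>
    inner ℂ ((D.commTest g u).1 p) (v.1 p) + inner ℂ (u.1 p) ((D.commTest g v).1 p) with hf
  have hfc : Continuous f :=
    (continuous_inner_sections (D.commTest g u) v).add (continuous_inner_sections u _)
  have h0 : ∀ᵐ x ∂μ, f x = 0 := by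
    refine ae_eq_zero_of_integral_contMDiff_smul_eq_zero (𝓡 n) hfc.locallyIntegrable
      fun h hh _ => ?_
    let h' : C^∞⟮𝓡 n, M; 𝓘(ℝ, ℂ), ℂ⟯ := ⟨fun x => (h x : ℂ),
      Complex.ofRealCLM.contDiff.contMDiff.comp hh⟩
    -- The commutator has order zero, so the test function `h` can be moved inside the section.
    set u' := mulTest h' u with hu'
    have hcomm : ∀ x, (D.commTest g u').1 x = h' x • (D.commTest g u).1 x := fun x =>
      D.comm_mulSection g h' (toSmooth u) x
    have h1 : ∀ x, h x • f x = inner ℂ ((D.commTest g u').1 x) (v.1 x) +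
        inner ℂ (u'.1 x) ((D.commTest g v).1 x) := fun x => by
      rw [hcomm, hu', mulTest_apply, inner_smul_left, inner_smul_left, ← mul_add,
        show conj (h' x) = (h x : ℂ) from Complex.conj_ofReal _, Complex.real_smul]
    have h2 : ∀ x, inner ℂ ((D.commTest g u').1 x) (v.1 x) =
        inner ℂ ((D.onTestSections (mulTest g u')).1 x) (v.1 x) -
          g x * inner ℂ ((D.onTestSections u').1 x) (v.1 x) := fun x => by
      rw [D.onTestSections_mulTest, inner_add_left, inner_smul_left, hg]
      ring
    have h3 : ∀ x, inner ℂ (u'.1 x) ((D.commTest g v).1 x) =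
        inner ℂ (u'.1 x) ((D.onTestSections (mulTest g v)).1 x) -
          g x * inner ℂ (u'.1 x) ((D.onTestSections v).1 x) := fun x => by
      rw [D.onTestSections_mulTest, inner_add_right, inner_smul_right]
      ring
    -- Symmetry moves `D` across, and the real factor `g` passes through the inner product. With
    -- `h5` the four integrals cancel in pairs.
    have h4 : ∫ x, inner ℂ ((D.onTestSections (mulTest g u')).1 x) (v.1 x) ∂μ =
        ∫ x, g x * inner ℂ (u'.1 x) ((D.onTestSections v).1 x) ∂μ := by
      rw [hD]
      exact integral_congr_ae (Filter.Eventually.of_forall fun x => by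
        simp only [mulTest_apply, inner_smul_left, hg])
    have h5 : ∫ x, inner ℂ (u'.1 x) ((D.onTestSections (mulTest g v)).1 x) ∂μ =
        ∫ x, g x * inner ℂ ((D.onTestSections u').1 x) (v.1 x) ∂μ := by
      rw [← hD]
      exact integral_congr_ae (Filter.Eventually.of_forall fun x => by
        simp only [mulTest_apply, inner_smul_right])
    have hgc : Continuous g := g.contMDiff.continuous
    simp only [h1, h2, h3]
    rw [integral_add, integral_sub, integral_sub, h4, h5]
    · ring
    · exact integrable_inner_sections μ u' _
    · exact integrable_mul_inner hgc u' _
    · exact integrable_inner_sections μ _ v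
    · exact integrable_mul_inner hgc _ v
    · exact (integrable_inner_sections μ _ v).sub (integrable_mul_inner hgc _ v)
    · exact (integrable_inner_sections μ u' _).sub (integrable_mul_inner hgc u' _)
  have h6 := congrFun ((hfc.ae_eq_iff_eq μ continuous_const).1 h0) p
  exact eq_neg_of_add_eq_zero_left h6

end TestSections

/-! ### Mollification in a coordinate patch -/

/-- Smooth real functions with compact support on `ℝⁿ`. -/
structure TestFun (n : ℕ) where
  toFun : EuclideanSpace ℝ (Fin n) → ℝ
  contDiff : ContDiff ℝ ∞ toFun
  hasCompactSupport : HasCompactSupport toFun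

namespace TestFun

variable {n : ℕ}

/-- A partial derivative. -/
def pderiv (η : TestFun n) (j : Fin n) : TestFun n where
  toFun z := fderiv ℝ η.toFun z (EuclideanSpace.single j 1)
  contDiff := (η.contDiff.fderiv_right (m := ∞) le_rfl).clm_apply contDiff_const
  hasCompactSupport := (η.hasCompactSupport.fderiv ℝ).comp_left
    (g := fun L : EuclideanSpace ℝ (Fin n) →L[ℝ] ℝ => L (EuclideanSpace.single j 1)) rfl

/-- The reflection at the origin. -/
def reflect (η : TestFun n) : TestFun n where
  toFun z := η.toFun (-z)
  contDiff := η.contDiff.comp contDiff_neg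
  hasCompactSupport := η.hasCompactSupport.comp_homeomorph (Homeomorph.neg _)

end TestFun

/-- A compact subset `K` of a manifold, contained in the domain of a chart, with a smooth extension
`ξ` of the restriction of the chart to `K`, where `dens` is the density of the measure. -/
structure Patch (n : ℕ) {M : Type*} [TopologicalSpace M]
    [ChartedSpace (EuclideanSpace ℝ (Fin n)) M] [MeasurableSpace M] (μ : Measure M) where
  ξ : C^∞⟮𝓡 n, M; 𝓘(ℝ, EuclideanSpace ℝ (Fin n)), EuclideanSpace ℝ (Fin n)⟯
  K : Set M
  isCompact : IsCompact K
  dens : M → ℝ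
  C : NNReal
  map_le : (μ.restrict K).map ξ ≤ (C : ENNReal) • volume
  transfer : ∀ g : M → ℂ, Continuous g → (∀ x ∉ K, g x = 0) →
    ∃ G : EuclideanSpace ℝ (Fin n) → ℂ, Continuous G ∧ HasCompactSupport G ∧
      (∀ x ∈ K, G (ξ x) = dens x • g x) ∧
      ∀ h : EuclideanSpace ℝ (Fin n) → ℝ, Continuous h →
        ∫ y, h (ξ y) • g y ∂μ = ∫ z, h z • G z

namespace Patch

variable {n : ℕ} {M : Type*} [TopologicalSpace M] [ChartedSpace (EuclideanSpace ℝ (Fin n)) M]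
  [MeasurableSpace M] {μ : Measure M} (P : Patch n μ)

/-- The convolution of a function `g` supported in a patch with `η`, in the coordinates `ξ`. -/
def mollify (η : TestFun n) (g : M → ℂ) (x : M) : ℂ :=
  ∫ y, η.toFun (P.ξ x - P.ξ y) • g y ∂μ

/-- After transfer to `ℝⁿ` the mollification is an ordinary convolution composed with `ξ`. It is
smooth although `g` is only continuous, because every derivative falls on `η`. -/
theorem exists_mollify_eq (η : TestFun n) {g : M → ℂ} (hg : Continuous g)
    (hgK : ∀ x ∉ P.K, g x = 0) :
    ∃ h : EuclideanSpace ℝ (Fin n) → ℂ, ContDiff ℝ ∞ h ∧ (∀ x, P.mollify η g x = h (P.ξ x)) ∧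
      ∀ x j, fderiv ℝ h (P.ξ x) (EuclideanSpace.single j 1) = P.mollify (η.pderiv j) g x := by
  obtain ⟨G, hGc, hGs, -, hG⟩ := P.transfer g hg hgK
  let L : ℂ →L[ℝ] ℝ →L[ℝ] ℂ := (ContinuousLinearMap.lsmul ℝ ℝ : ℝ →L[ℝ] ℂ →L[ℝ] ℂ).flip
  have hGl : LocallyIntegrable G volume := hGc.locallyIntegrable
  have hconv : ∀ (θ : TestFun n) x, P.mollify θ g x = convolution G θ.toFun L volume (P.ξ x) :=
    fun θ x => hG (fun z => θ.toFun (P.ξ x - z))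
      (θ.contDiff.continuous.comp (continuous_const.sub continuous_id))
  refine ⟨convolution G η.toFun L volume,
    η.hasCompactSupport.contDiff_convolution_right L hGl η.contDiff, hconv η, fun x j => ?_⟩
  rw [(η.hasCompactSupport.hasFDerivAt_convolution_right L hGl (η.contDiff.of_le (by simp))
    (P.ξ x)).fderiv, convolution_precompR_apply L hGl (η.hasCompactSupport.fderiv ℝ)
    (η.contDiff.continuous_fderiv (by simp)), hconv]
  rfl

/-- Mollification, as a smooth function. -/
def mollifyFn (η : TestFun n) (g : M → ℂ) (hg : Continuous g) (hgK : ∀ x ∉ P.K, g x = 0) :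
    C^∞⟮𝓡 n, M; 𝓘(ℝ, ℂ), ℂ⟯ :=
  ⟨P.mollify η g, by
    obtain ⟨h, hh, hm, -⟩ := P.exists_mollify_eq η hg hgK
    rw [show P.mollify η g = h ∘ P.ξ from funext hm]
    exact hh.contMDiff.comp P.ξ.contMDiff⟩

@[simp]
theorem mollifyFn_apply (η : TestFun n) (g : M → ℂ) (hg : Continuous g)
    (hgK : ∀ x ∉ P.K, g x = 0) (x : M) : P.mollifyFn η g hg hgK x = P.mollify η g x := rfl

theorem continuous_mollify (η : TestFun n) {g : M → ℂ} (hg : Continuous g)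
    (hgK : ∀ x ∉ P.K, g x = 0) : Continuous (P.mollify η g) :=
  (P.mollifyFn η g hg hgK).contMDiff.continuous

variable [T2Space M] [BorelSpace M] [IsManifold (𝓡 n) ∞ M] [IsSmoothMeasure n μ]

theorem integrable_mollify_integrand (η : TestFun n) {g : M → ℂ} (hg : Continuous g)
    (hgK : ∀ x ∉ P.K, g x = 0) (x : M) :
    Integrable (fun y => η.toFun (P.ξ x - P.ξ y) • g y) μ := by
  have := isLocallyFiniteMeasure n μ
  refine Continuous.integrable_of_hasCompactSupport ?_ ?_
  · exact (η.contDiff.continuous.comp (continuous_const.sub P.ξ.contMDiff.continuous)).smul hg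
  · exact HasCompactSupport.intro P.isCompact fun y hy => by rw [hgK y hy, smul_zero]

theorem mollify_add (η : TestFun n) {g₁ g₂ : M → ℂ} (h₁ : Continuous g₁)
    (h₁' : ∀ x ∉ P.K, g₁ x = 0) (h₂ : Continuous g₂) (h₂' : ∀ x ∉ P.K, g₂ x = 0) (x : M) :
    P.mollify η (fun y => g₁ y + g₂ y) x = P.mollify η g₁ x + P.mollify η g₂ x := by
  simp only [mollify, smul_add]
  exact integral_add (P.integrable_mollify_integrand η h₁ h₁' x)
    (P.integrable_mollify_integrand η h₂ h₂' x)

theorem mollify_sub (η : TestFun n) {g₁ g₂ : M → ℂ} (h₁ : Continuous g₁)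
    (h₁' : ∀ x ∉ P.K, g₁ x = 0) (h₂ : Continuous g₂) (h₂' : ∀ x ∉ P.K, g₂ x = 0) (x : M) :
    P.mollify η (fun y => g₁ y - g₂ y) x = P.mollify η g₁ x - P.mollify η g₂ x := by
  simp only [mollify, smul_sub]
  exact integral_sub (P.integrable_mollify_integrand η h₁ h₁' x)
    (P.integrable_mollify_integrand η h₂ h₂' x)

omit [T2Space M] [BorelSpace M] [IsManifold (𝓡 n) ∞ M] [IsSmoothMeasure n μ] in
theorem mollify_const_mul (η : TestFun n) (c : ℂ) (g : M → ℂ) (x : M) :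
    P.mollify η (fun y => c * g y) x = c * P.mollify η g x := by
  simp only [mollify, ← integral_const_mul]
  exact integral_congr_ae (Filter.Eventually.of_forall fun y => mul_smul_comm _ _ _ |>.symm)

theorem mollify_sum (η : TestFun n) {ι : Type*} (s : Finset ι) {g : ι → M → ℂ}
    (h : ∀ a, Continuous (g a)) (h' : ∀ a, ∀ x ∉ P.K, g a x = 0) (x : M) :
    P.mollify η (fun y => ∑ a ∈ s, g a y) x = ∑ a ∈ s, P.mollify η (g a) x := by
  simp only [mollify, Finset.smul_sum]
  exact integral_finsetSum _ fun a _ => P.integrable_mollify_integrand η (h a) (h' a) x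

/-- Fubini's theorem for mollifications. -/
theorem integral_mul_mollify (η : TestFun n) {f g : M → ℂ} (hf : Continuous f)
    (hfK : ∀ x ∉ P.K, f x = 0) (hg : Continuous g) (hgK : ∀ x ∉ P.K, g x = 0) :
    ∫ x, f x * P.mollify η g x ∂μ = ∫ y, P.mollify η.reflect f y * g y ∂μ := by
  have := isLocallyFiniteMeasure n μ
  have hξ : Continuous P.ξ := P.ξ.contMDiff.continuous
  have hη : Continuous η.toFun := η.contDiff.continuous
  have h1 : ∀ x, f x * P.mollify η g x = ∫ y, f x * (η.toFun (P.ξ x - P.ξ y) • g y) ∂μ :=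
    fun x => (integral_const_mul _ _).symm
  have h2 : ∀ y, P.mollify η.reflect f y * g y =
      ∫ x, f x * (η.toFun (P.ξ x - P.ξ y) • g y) ∂μ := fun y => by
    rw [mollify, ← integral_mul_const]
    refine integral_congr_ae (Filter.Eventually.of_forall fun x => ?_)
    simp only [TestFun.reflect, neg_sub, Complex.real_smul]
    ring
  simp only [h1, h2]
  refine integral_integral_swap_of_hasCompactSupport ?_ ?_
  · simp only [Function.uncurry_def]
    fun_prop
  · refine HasCompactSupport.intro (P.isCompact.prod P.isCompact) fun q hq => ?_
    simp only [Function.uncurry_def]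
    rw [mem_prod, not_and_or] at hq
    rcases hq with hq | hq
    · rw [hfK _ hq, zero_mul]
    · rw [hgK _ hq, smul_zero, mul_zero]

end Patch

/-! ### Regularizing operators and their commutators -/

namespace Patch

variable {n : ℕ} {M : Type*} [TopologicalSpace M] [ChartedSpace (EuclideanSpace ℝ (Fin n)) M]
  [MeasurableSpace M] {μ : Measure M} (P : Patch n μ)
  {F : Type*} [NormedAddCommGroup F] [NormedSpace ℂ F]
  {S : M → Type*} [TopologicalSpace (TotalSpace F S)]
  [∀ p, NormedAddCommGroup (S p)] [∀ p, InnerProductSpace ℂ (S p)]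
  [FiberBundle F S] [VectorBundle ℂ F S]

theorem inner_left_eq_zero {s : testSections n F S} (hs : ∀ x ∉ P.K, s.1 x = 0) (ψ : ∀ p, S p) :
    ∀ x ∉ P.K, inner ℂ (s.1 x) (ψ x) = 0 := fun x hx => by rw [hs x hx, inner_zero_left]

theorem inner_right_eq_zero {s : testSections n F S} (hs : ∀ x ∉ P.K, s.1 x = 0) (ψ : ∀ p, S p) :
    ∀ x ∉ P.K, inner ℂ (ψ x) (s.1 x) = 0 := fun x hx => by rw [hs x hx, inner_zero_right]

variable [IsManifold (𝓡 n) ∞ M]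

theorem onTestSections_mul_mollifyFn (D : DifferentialOperator n F S) (η : TestFun n) {g : M → ℂ}
    (hg : Continuous g) (hgK : ∀ x ∉ P.K, g x = 0) (t : testSections n F S) (x : M) :
    (D.onTestSections (mulTest (P.mollifyFn η g hg hgK) t)).1 x =
      P.mollify η g x • (D.onTestSections t).1 x +
      ∑ j, P.mollify (η.pderiv j) g x • (D.commTest (coordFn P.ξ j) t).1 x := by
  obtain ⟨h, hh, hm, hd⟩ := P.exists_mollify_eq η hg hgK
  rw [D.onTestSections_mulTest, D.commTest_apply, D.comm_comp P.ξ hh _ hm]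
  simp only [hd, mollifyFn_apply, D.commTest_apply]

variable [BorelSpace M] [IsSmoothHermitian n F S] [IsSmoothMeasure n μ]

theorem integral_inner_sum_smul (φ : testSections n F S) {κ : Type*} (f : Finset κ)
    {g : κ → M → ℂ} (hg : ∀ a, Continuous (g a)) (t : κ → testSections n F S) :
    ∫ x, inner ℂ (φ.1 x) (∑ a ∈ f, g a x • (t a).1 x) ∂μ =
      ∑ a ∈ f, ∫ x, inner ℂ (φ.1 x) ((t a).1 x) * g a x ∂μ := by
  rw [← integral_finsetSum]
  · refine integral_congr_ae (Filter.Eventually.of_forall fun x => ?_)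
    simp only [inner_sum, inner_smul_right, mul_comm]
  · intro a _
    simpa only [mul_comm] using integrable_mul_inner (hg a) φ (t a)

variable [T2Space M]

/-- An integration by parts without coordinates: for fixed `x` the kernel is a real function `k` of
`y`, absorbed into `s` before symmetry is used. The sum comes from `[D, k]`, and its sign from
differentiating `η (ξ x - ·)`. -/
theorem mollify_inner_onTestSections {D : DifferentialOperator n F S}
    (hD : D.IsFormallySymmetric μ) (η : TestFun n) {s : testSections n F S}
    (hs : ∀ x ∉ P.K, s.1 x = 0) (ψ : testSections n F S) (x : M) :
    P.mollify η (fun y => inner ℂ (s.1 y) ((D.onTestSections ψ).1 y)) x =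
      P.mollify η (fun y => inner ℂ ((D.onTestSections s).1 y) (ψ.1 y)) x -
      ∑ j, P.mollify (η.pderiv j)
        (fun y => inner ℂ ((D.commTest (coordFn P.ξ j) s).1 y) (ψ.1 y)) x := by
  set h : EuclideanSpace ℝ (Fin n) → ℂ := fun z => (η.toFun (P.ξ x - z) : ℂ) with hh
  have hη : ContDiff ℝ ∞ fun z => η.toFun (P.ξ x - z) :=
    η.contDiff.comp (contDiff_const.sub contDiff_id)
  have hhd : ContDiff ℝ ∞ h := Complex.ofRealCLM.contDiff.comp hη
  have hfd : ∀ z v, fderiv ℝ h z v = -(fderiv ℝ η.toFun (P.ξ x - z) v : ℂ) := fun z v => by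
    have h1 : HasFDerivAt η.toFun _ (P.ξ x - z) :=
      (η.contDiff.differentiable (by simp) (P.ξ x - z)).hasFDerivAt
    have h2 := h1.comp z ((hasFDerivAt_id z).const_sub (P.ξ x))
    have h3 := (Complex.ofRealCLM.hasFDerivAt (x := η.toFun (P.ξ x - z))).comp z h2
    have h4 : h = Complex.ofRealCLM ∘ (η.toFun ∘ fun z => P.ξ x - z) := rfl
    rw [h4]
    erw [h3.fderiv]
    simp
  let k : C^∞⟮𝓡 n, M; 𝓘(ℝ, ℂ), ℂ⟯ := ⟨fun y => h (P.ξ y), hhd.contMDiff.comp P.ξ.contMDiff⟩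
  have hk : ∀ y, conj (k y) = k y := fun y => Complex.conj_ofReal _
  have hkv : ∀ y, k y = (η.toFun (P.ξ x - P.ξ y) : ℂ) := fun y => rfl
  have e1 : P.mollify η (fun y => inner ℂ (s.1 y) ((D.onTestSections ψ).1 y)) x =
      ∫ y, inner ℂ ((D.onTestSections (mulTest k s)).1 y) (ψ.1 y) ∂μ := by
    rw [hD]
    refine integral_congr_ae (Filter.Eventually.of_forall fun y => ?_)
    simp only [mulTest_apply, inner_smul_left, hkv, Complex.conj_ofReal, Complex.real_smul]
  have e2 : ∀ y, inner ℂ ((D.onTestSections (mulTest k s)).1 y) (ψ.1 y) =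
      η.toFun (P.ξ x - P.ξ y) • inner ℂ ((D.onTestSections s).1 y) (ψ.1 y) -
      ∑ j, (η.pderiv j).toFun (P.ξ x - P.ξ y) •
        inner ℂ ((D.commTest (coordFn P.ξ j) s).1 y) (ψ.1 y) := fun y => by
    rw [D.onTestSections_mulTest, D.commTest_apply, D.comm_comp P.ξ hhd k (fun _ => rfl),
      inner_add_left, inner_smul_left, hk, hkv, sum_inner, Complex.real_smul]
    refine (congrArg₂ (· + ·) rfl ?_).trans (sub_eq_add_neg _ _).symm
    rw [← Finset.sum_neg_distrib]
    refine Finset.sum_congr rfl fun j _ => ?_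
    rw [inner_smul_left, hfd, map_neg, Complex.conj_ofReal, D.commTest_apply, Complex.real_smul,
      neg_mul]
    rfl
  rw [e1]
  simp only [e2]
  have hz : ∀ j, ∀ y ∉ P.K, (D.commTest (coordFn P.ξ j) s).1 y = 0 := fun j y hy =>
    D.commTest_eq_zero _ (hs y hy)
  rw [integral_sub, integral_finsetSum]
  · rfl
  · exact fun j _ => P.integrable_mollify_integrand _ (continuous_inner_sections _ ψ)
      (P.inner_left_eq_zero (hz j) ψ.1) x
  · exact P.integrable_mollify_integrand _ (continuous_inner_sections _ ψ)
      (P.inner_left_eq_zero (fun y hy => D.onTestSections_eq_zero P.isCompact.isClosed hs hy) ψ.1) x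
  · exact integrable_finsetSum _ fun j _ =>
      P.integrable_mollify_integrand _ (continuous_inner_sections _ ψ)
        (P.inner_left_eq_zero (hz j) ψ.1) x

variable {ι : Type*} [Fintype ι]

/-- The regularizing operator `ψ ↦ ∑ a, (η * ⟪s a, ψ⟫) • t a`. -/
def regularize (η : TestFun n) (s t : ι → testSections n F S)
    (hs : ∀ a, ∀ x ∉ P.K, (s a).1 x = 0) : testSections n F S →ₗ[ℂ] testSections n F S where
  toFun ψ := ∑ a, mulTest (P.mollifyFn η (fun y => inner ℂ ((s a).1 y) (ψ.1 y))
    (continuous_inner_sections (s a) ψ) (P.inner_left_eq_zero (hs a) ψ.1)) (t a)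
  map_add' ψ₁ ψ₂ := by
    refine Subtype.ext (funext fun x => ?_)
    have h : ∀ a, P.mollify η (fun y => inner ℂ ((s a).1 y) ((ψ₁ + ψ₂).1 y)) x =
        P.mollify η (fun y => inner ℂ ((s a).1 y) (ψ₁.1 y)) x +
        P.mollify η (fun y => inner ℂ ((s a).1 y) (ψ₂.1 y)) x := fun a => by
      rw [← P.mollify_add η (continuous_inner_sections (s a) ψ₁)
        (P.inner_left_eq_zero (hs a) ψ₁.1) (continuous_inner_sections (s a) ψ₂)
        (P.inner_left_eq_zero (hs a) ψ₂.1)]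
      exact congrArg (fun g => P.mollify η g x) (funext fun y => inner_add_right _ _ _)
    change _ = (∑ a, _ : testSections n F S).1 x + (∑ a, _ : testSections n F S).1 x
    simp only [coe_sum_testSections, mulTest_apply, mollifyFn_apply, h, add_smul,
      Finset.sum_add_distrib]
  map_smul' c ψ := by
    refine Subtype.ext (funext fun x => ?_)
    have h : ∀ a, P.mollify η (fun y => inner ℂ ((s a).1 y) ((c • ψ).1 y)) x =
        c * P.mollify η (fun y => inner ℂ ((s a).1 y) (ψ.1 y)) x := fun a => by
      rw [← P.mollify_const_mul]
      exact congrArg (fun g => P.mollify η g x) (funext fun y => inner_smul_right _ _ _)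
    change _ = c • (∑ a, _ : testSections n F S).1 x
    simp only [coe_sum_testSections, mulTest_apply, mollifyFn_apply, h, mul_smul,
      Finset.smul_sum]

theorem regularize_apply (η : TestFun n) (s t : ι → testSections n F S)
    (hs : ∀ a, ∀ x ∉ P.K, (s a).1 x = 0) (ψ : testSections n F S) (x : M) :
    (P.regularize η s t hs ψ).1 x =
      ∑ a, P.mollify η (fun y => inner ℂ ((s a).1 y) (ψ.1 y)) x • (t a).1 x := by
  simp only [regularize, LinearMap.coe_mk, AddHom.coe_mk, coe_sum_testSections, mulTest_apply,
    mollifyFn_apply]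

theorem integral_inner_regularize (η : TestFun n) (s t : ι → testSections n F S)
    (hs : ∀ a, ∀ x ∉ P.K, (s a).1 x = 0) (φ ψ : testSections n F S) :
    ∫ x, inner ℂ (φ.1 x) ((P.regularize η s t hs ψ).1 x) ∂μ =
      ∑ a, ∫ x, inner ℂ (φ.1 x) ((t a).1 x) *
        P.mollify η (fun y => inner ℂ ((s a).1 y) (ψ.1 y)) x ∂μ := by
  simp only [regularize_apply]
  exact integral_inner_sum_smul φ _ (fun a => P.continuous_mollify η
    (continuous_inner_sections (s a) ψ) (P.inner_left_eq_zero (hs a) ψ.1)) t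

/-- The formal adjoint of a regularizing operator. -/
theorem integral_inner_regularize_eq (η : TestFun n) (s t : ι → testSections n F S)
    (hs : ∀ a, ∀ x ∉ P.K, (s a).1 x = 0) (ht : ∀ a, ∀ x ∉ P.K, (t a).1 x = 0)
    (φ ψ : testSections n F S) :
    ∫ x, inner ℂ (φ.1 x) ((P.regularize η s t hs ψ).1 x) ∂μ =
      ∫ x, inner ℂ ((P.regularize η.reflect t s ht φ).1 x) (ψ.1 x) ∂μ := by
  rw [integral_inner_regularize]
  have h1 : ∀ x, inner ℂ ((P.regularize η.reflect t s ht φ).1 x) (ψ.1 x) =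
      ∑ a, P.mollify η.reflect (fun y => inner ℂ (φ.1 y) ((t a).1 y)) x *
        inner ℂ ((s a).1 x) (ψ.1 x) := fun x => by
    rw [regularize_apply, sum_inner]
    refine Finset.sum_congr rfl fun a _ => ?_
    rw [inner_smul_left, mollify, mollify, ← integral_conj]
    congr 1
    refine integral_congr_ae (Filter.Eventually.of_forall fun y => ?_)
    simp only [Complex.real_smul, map_mul, Complex.conj_ofReal, inner_conj_symm]
  simp only [h1]
  rw [integral_finsetSum]
  · exact Finset.sum_congr rfl fun a _ => P.integral_mul_mollify η
      (continuous_inner_sections φ (t a)) (P.inner_right_eq_zero (ht a) φ.1)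
      (continuous_inner_sections (s a) ψ) (P.inner_left_eq_zero (hs a) ψ.1)
  · exact fun a _ => integrable_mul_inner (P.continuous_mollify _
      (continuous_inner_sections φ (t a)) (P.inner_right_eq_zero (ht a) φ.1)) (s a) ψ

theorem onTestSections_regularize (D : DifferentialOperator n F S) (η : TestFun n)
    (s t : ι → testSections n F S) (hs : ∀ a, ∀ x ∉ P.K, (s a).1 x = 0) (ψ : testSections n F S)
    (x : M) :
    (D.onTestSections (P.regularize η s t hs ψ)).1 x =
      ∑ a, P.mollify η (fun y => inner ℂ ((s a).1 y) (ψ.1 y)) x • (D.onTestSections (t a)).1 x +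
      ∑ a, ∑ j, P.mollify (η.pderiv j) (fun y => inner ℂ ((s a).1 y) (ψ.1 y)) x •
        (D.commTest (coordFn P.ξ j) (t a)).1 x := by
  simp only [regularize, LinearMap.coe_mk, AddHom.coe_mk, map_sum, coe_sum_testSections,
    onTestSections_mul_mollifyFn, Finset.sum_add_distrib]

/-- The commutator of a symmetric differential operator and a regularizing operator, if the sections
`s` and `t` are obtained from dual local frames. -/
theorem commutator_regularize {D : DifferentialOperator n F S} (hD : D.IsFormallySymmetric μ)
    (η : TestFun n) (s t : ι → testSections n F S) (hs : ∀ a, ∀ x ∉ P.K, (s a).1 x = 0)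
    (d : Fin n → ι → ι → M → ℂ) (hd : ∀ j a b, Continuous (d j a b))
    (hdt : ∀ j a x, (D.commTest (coordFn P.ξ j) (t a)).1 x = ∑ b, d j a b x • (t b).1 x)
    (hds : ∀ j a x, (D.commTest (coordFn P.ξ j) (s a)).1 x =
      -∑ b, conj (d j b a x) • (s b).1 x) (ψ : testSections n F S) (x : M) :
    (D.onTestSections (P.regularize η s t hs ψ)).1 x -
        (P.regularize η s t hs (D.onTestSections ψ)).1 x =
      ∑ a, P.mollify η (fun y => inner ℂ ((s a).1 y) (ψ.1 y)) x • (D.onTestSections (t a)).1 x -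
      ∑ a, P.mollify η (fun y => inner ℂ ((D.onTestSections (s a)).1 y) (ψ.1 y)) x • (t a).1 x +
      ∑ q : ι × Fin n × ι, (d q.2.1 q.1 q.2.2 x *
          P.mollify (η.pderiv q.2.1) (fun y => inner ℂ ((s q.1).1 y) (ψ.1 y)) x -
        P.mollify (η.pderiv q.2.1)
          (fun y => d q.2.1 q.1 q.2.2 y * inner ℂ ((s q.1).1 y) (ψ.1 y)) x) • (t q.2.2).1 x := by
  rw [onTestSections_regularize, regularize_apply]
  -- The conjugates in `hds` disappear because the inner product is conjugate-linear in its first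
  -- argument.
  have h1 : ∀ j a, P.mollify (η.pderiv j)
      (fun y => inner ℂ ((D.commTest (coordFn P.ξ j) (s a)).1 y) (ψ.1 y)) x =
      -∑ b, P.mollify (η.pderiv j) (fun y => d j b a y * inner ℂ ((s b).1 y) (ψ.1 y)) x :=
    fun j a => by
    have h2 : (fun y => inner ℂ ((D.commTest (coordFn P.ξ j) (s a)).1 y) (ψ.1 y)) =
        fun y => (-1 : ℂ) * ∑ b, d j b a y * inner ℂ ((s b).1 y) (ψ.1 y) := funext fun y => by
      rw [hds, inner_neg_left, sum_inner, neg_one_mul]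
      simp only [inner_smul_left, Complex.conj_conj]
    rw [h2, P.mollify_const_mul, P.mollify_sum, neg_one_mul]
    · exact fun b => (hd j b a).mul (continuous_inner_sections (s b) ψ)
    · intro b y hy
      rw [P.inner_left_eq_zero (hs b) ψ.1 y hy, mul_zero]
  have h3 : ∀ a, P.mollify η (fun y => inner ℂ ((s a).1 y) ((D.onTestSections ψ).1 y)) x =
      P.mollify η (fun y => inner ℂ ((D.onTestSections (s a)).1 y) (ψ.1 y)) x +
      ∑ j, ∑ b, P.mollify (η.pderiv j) (fun y => d j b a y * inner ℂ ((s b).1 y) (ψ.1 y)) x :=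
    fun a => by
    rw [P.mollify_inner_onTestSections hD η (hs a)]
    simp only [h1, Finset.sum_neg_distrib, sub_neg_eq_add]
  simp only [h3, hdt, add_smul, sub_smul, Finset.sum_add_distrib, Finset.sum_sub_distrib,
    Fintype.sum_prod_type, Finset.sum_smul, Finset.smul_sum, smul_smul]
  -- Interchanging `a` and `b` attaches both singular sums to the same section `t b`. Their
  -- difference is then a commutator of convolution and multiplication by `d`.
  rw [show ∑ a, ∑ j, ∑ b, P.mollify (η.pderiv j)
        (fun y => d j b a y * inner ℂ ((s b).1 y) (ψ.1 y)) x • (t a).1 x =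
      ∑ a, ∑ j, ∑ b, P.mollify (η.pderiv j)
        (fun y => d j a b y * inner ℂ ((s a).1 y) (ψ.1 y)) x • (t b).1 x from by
    rw [Finset.sum_comm, Finset.sum_comm (s := Finset.univ (α := ι))]
    exact Finset.sum_congr rfl fun j _ => Finset.sum_comm]
  simp only [mul_comm]
  abel

end Patch

/-! ### Estimates for regularizing operators -/

section NormSq

variable {n : ℕ} {M : Type*} [TopologicalSpace M] [ChartedSpace (EuclideanSpace ℝ (Fin n)) M]
  {F : Type*} [NormedAddCommGroup F] [NormedSpace ℂ F]
  {S : M → Type*} [TopologicalSpace (TotalSpace F S)]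
  [∀ p, NormedAddCommGroup (S p)] [∀ p, InnerProductSpace ℂ (S p)]
  [FiberBundle F S] [VectorBundle ℂ F S]

variable [IsSmoothHermitian n F S]

theorem continuous_norm_sq (u : testSections n F S) : Continuous fun p => ‖u.1 p‖ ^ 2 := by
  simp only [← inner_self_eq_norm_sq (𝕜 := ℂ)]
  exact RCLike.continuous_re.comp (continuous_inner_sections u u)

theorem exists_norm_le (u : testSections n F S) : ∃ b : ℝ, 0 ≤ b ∧ ∀ p, ‖u.1 p‖ ≤ b := by
  have hs : HasCompactSupport fun p => ‖u.1 p‖ ^ 2 :=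
    u.2.2.of_isClosed_subset isClosed_closure (closure_mono fun p hp h0 => hp (by simp [h0]))
  obtain ⟨b, hb⟩ := hs.exists_bound_of_continuous (continuous_norm_sq u)
  -- Here `b` bounds the squared norm, and `r ≤ 1 + r ^ 2`.
  refine ⟨1 + |b|, by positivity, fun p => ?_⟩
  have := (hb p).trans (le_abs_self b)
  rw [norm_pow, norm_norm] at this
  nlinarith [norm_nonneg (u.1 p), sq_nonneg (‖u.1 p‖ - 1)]

variable [MeasurableSpace M] (μ : Measure M)

/-- The square of the `L²`-norm of a section. -/
def normSq (u : testSections n F S) : ℝ := ∫ p, ‖u.1 p‖ ^ 2 ∂μ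

omit [IsSmoothHermitian n F S] in
theorem normSq_nonneg (u : testSections n F S) : 0 ≤ normSq μ u :=
  integral_nonneg fun _ => sq_nonneg _

variable [IsManifold (𝓡 n) ∞ M] [BorelSpace M] [IsSmoothMeasure n μ]

theorem lintegral_enorm_sq (u : testSections n F S) :
    ∫⁻ p, ‖u.1 p‖ₑ ^ 2 ∂μ = ENNReal.ofReal (normSq μ u) := by
  have hi : Integrable (fun p => ‖u.1 p‖ ^ 2) μ := by
    simp only [← inner_self_eq_norm_sq (𝕜 := ℂ)]
    exact (integrable_inner_sections μ u u).re
  rw [normSq, ofReal_integral_eq_lintegral_ofReal hi (Filter.Eventually.of_forall fun p =>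
    sq_nonneg _)]
  refine lintegral_congr fun p => ?_
  rw [ENNReal.ofReal_pow (norm_nonneg _), ofReal_norm]

theorem lintegral_enorm_inner_sq_le {t : testSections n F S} {b : ℝ} (hb : 0 ≤ b)
    (ht : ∀ p, ‖t.1 p‖ ≤ b) (u : testSections n F S) :
    ∫⁻ p, ‖inner ℂ (u.1 p) (t.1 p)‖ₑ ^ 2 ∂μ ≤ ENNReal.ofReal (b ^ 2 * normSq μ u) := by
  rw [ENNReal.ofReal_mul (sq_nonneg _), ← lintegral_enorm_sq,
    ← lintegral_const_mul' _ _ ENNReal.ofReal_ne_top]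
  refine lintegral_mono fun p => ?_
  rw [ENNReal.ofReal_pow hb, ← mul_pow]
  refine pow_le_pow_left' ?_ 2
  rw [← ofReal_norm, ← ofReal_norm, ← ENNReal.ofReal_mul hb]
  refine ENNReal.ofReal_le_ofReal ((norm_inner_le_norm _ _).trans ?_)
  rw [mul_comm]
  exact mul_le_mul_of_nonneg_right (ht p) (norm_nonneg _)

end NormSq

/-! ### Kernel estimates in a patch -/

namespace Patch

variable {n : ℕ} {M : Type*} [TopologicalSpace M] [ChartedSpace (EuclideanSpace ℝ (Fin n)) M]
  [MeasurableSpace M] {μ : Measure M} (P : Patch n μ)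

theorem enorm_mollify_le (η : TestFun n) {g : M → ℂ} (hgK : ∀ x ∉ P.K, g x = 0) (x : M) :
    ‖P.mollify η g x‖ₑ ≤ ∫⁻ y in P.K, ‖η.toFun (P.ξ x - P.ξ y)‖ₑ * ‖g y‖ₑ ∂μ := by
  rw [mollify, ← setIntegral_eq_integral_of_forall_compl_eq_zero (s := P.K)
    (fun y hy => by rw [hgK y hy, smul_zero])]
  refine (enorm_integral_le_lintegral_enorm _).trans_eq ?_
  simp only [enorm_smul]

variable [BorelSpace M]

theorem lintegral_comp_le {κ : EuclideanSpace ℝ (Fin n) → ENNReal} (hκ : Measurable κ) :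
    ∫⁻ y in P.K, κ (P.ξ y) ∂μ ≤ P.C * ∫⁻ z, κ z := by
  rw [← lintegral_map hκ P.ξ.contMDiff.continuous.measurable]
  refine (lintegral_mono' P.map_le le_rfl).trans_eq ?_
  rw [lintegral_smul_measure, smul_eq_mul]

/-- The Schur test for convolution kernels. -/
theorem lintegral_schur [SFinite μ] {κ : EuclideanSpace ℝ (Fin n) → ENNReal} (hκ : Measurable κ)
    {p q : M → ENNReal} (hp : Measurable p) (hq : Measurable q) :
    ∫⁻ x in P.K, p x * ∫⁻ y in P.K, κ (P.ξ x - P.ξ y) * q y ∂μ ∂μ ≤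
      P.C * (∫⁻ z, κ z) * (∫⁻ x in P.K, p x ^ 2 ∂μ + ∫⁻ x in P.K, q x ^ 2 ∂μ) := by
  have hξ : Measurable P.ξ := P.ξ.contMDiff.continuous.measurable
  -- Domination by Lebesgue measure together with its invariance under translation and reflection
  -- makes the row and column bounds independent of the point.
  have h1 : ∀ x, ∫⁻ y in P.K, κ (P.ξ x - P.ξ y) ∂μ ≤ P.C * ∫⁻ z, κ z := fun x => by
    refine (P.lintegral_comp_le (κ := fun z => κ (P.ξ x - z)) (by fun_prop)).trans_eq ?_
    rw [lintegral_sub_left_eq_self κ]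
  have h2 : ∀ y, ∫⁻ x in P.K, κ (P.ξ x - P.ξ y) ∂μ ≤ P.C * ∫⁻ z, κ z := fun y => by
    refine (P.lintegral_comp_le (κ := fun z => κ (z - P.ξ y)) (by fun_prop)).trans_eq ?_
    rw [lintegral_sub_right_eq_self κ]
  -- A sum of squares suffices, since `norm_le_of_norm_inner_le` later recovers the operator norm by
  -- rescaling.
  have hpq : ∀ a b : ENNReal, a * b ≤ a ^ 2 + b ^ 2 := fun a b => by
    rcases le_total a b with h | h
    · exact (mul_le_mul_left h b).trans (by rw [sq b]; exact le_add_self)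
    · exact (mul_le_mul_right h a).trans (by rw [sq a]; exact le_self_add)
  calc ∫⁻ x in P.K, p x * ∫⁻ y in P.K, κ (P.ξ x - P.ξ y) * q y ∂μ ∂μ
      ≤ ∫⁻ x in P.K, (p x ^ 2 * ∫⁻ y in P.K, κ (P.ξ x - P.ξ y) ∂μ) +
          ∫⁻ y in P.K, κ (P.ξ x - P.ξ y) * q y ^ 2 ∂μ ∂μ := by
        refine lintegral_mono fun x => ?_
        rw [← lintegral_const_mul _ (by fun_prop), ← lintegral_const_mul _ (by fun_prop),
          ← lintegral_add_left (by fun_prop)]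
        refine lintegral_mono fun y => ?_
        calc p x * (κ (P.ξ x - P.ξ y) * q y) = κ (P.ξ x - P.ξ y) * (p x * q y) := by ring
          _ ≤ κ (P.ξ x - P.ξ y) * (p x ^ 2 + q y ^ 2) := by gcongr; exact hpq _ _
          _ = _ := by ring
    _ = (∫⁻ x in P.K, p x ^ 2 * ∫⁻ y in P.K, κ (P.ξ x - P.ξ y) ∂μ ∂μ) +
          ∫⁻ y in P.K, (∫⁻ x in P.K, κ (P.ξ x - P.ξ y) ∂μ) * q y ^ 2 ∂μ := by
        rw [lintegral_add_left]
        · congr 1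
          rw [lintegral_lintegral_swap (by fun_prop)]
          exact lintegral_congr fun y => lintegral_mul_const _ (by fun_prop)
        · refine (hp.pow_const 2).mul ?_
          exact Measurable.lintegral_prod_right' (f := fun q : M × M => κ (P.ξ q.1 - P.ξ q.2))
            (by fun_prop)
    _ ≤ (∫⁻ x in P.K, p x ^ 2 * (P.C * ∫⁻ z, κ z) ∂μ) +
          ∫⁻ y in P.K, (P.C * ∫⁻ z, κ z) * q y ^ 2 ∂μ := by
        gcongr with x y
        · exact h1 x
        · exact h2 y
    _ = _ := by
        rw [lintegral_mul_const _ (by fun_prop), lintegral_const_mul _ (by fun_prop)]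
        ring

variable [T2Space M] [IsManifold (𝓡 n) ∞ M] [IsSmoothMeasure n μ]

/-- The difference is an integral operator with kernel `(d x - d y) η(ξ x - ξ y)`. The Lipschitz
bound supplies the factor `‖ξ x - ξ y‖` that offsets one derivative of a rescaled mollifier. -/
theorem enorm_mollify_commutator_le (η : TestFun n) {g d : M → ℂ} (hg : Continuous g)
    (hgK : ∀ x ∉ P.K, g x = 0) (hd : Continuous d) {L : NNReal}
    (hL : ∀ x ∈ P.K, ∀ y ∈ P.K, ‖d x - d y‖ ≤ L * ‖P.ξ x - P.ξ y‖) {x : M} (hx : x ∈ P.K) :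
    ‖d x * P.mollify η g x - P.mollify η (fun y => d y * g y) x‖ₑ ≤
      ∫⁻ y in P.K, L * (‖η.toFun (P.ξ x - P.ξ y)‖ₑ * ‖P.ξ x - P.ξ y‖ₑ) * ‖g y‖ₑ ∂μ := by
  have h1 : d x * P.mollify η g x - P.mollify η (fun y => d y * g y) x =
      P.mollify η (fun y => (d x - d y) * g y) x := by
    rw [← P.mollify_const_mul, ← P.mollify_sub]
    · simp only [sub_mul]
    · exact continuous_const.mul hg
    · exact fun y hy => by rw [hgK y hy, mul_zero]
    · exact hd.mul hg
    · exact fun y hy => by rw [hgK y hy, mul_zero]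
  rw [h1]
  refine (P.enorm_mollify_le η (fun y hy => by rw [hgK y hy, mul_zero]) x).trans ?_
  refine setLIntegral_mono' P.isCompact.measurableSet fun y hy => ?_
  have h2 : ‖d x - d y‖ₑ ≤ L * ‖P.ξ x - P.ξ y‖ₑ := by
    have := ENNReal.ofReal_le_ofReal (hL x hx y hy)
    rwa [ENNReal.ofReal_mul L.coe_nonneg, ofReal_norm, ofReal_norm,
      ENNReal.ofReal_coe_nnreal] at this
  calc ‖η.toFun (P.ξ x - P.ξ y)‖ₑ * ‖(d x - d y) * g y‖ₑ
      = ‖η.toFun (P.ξ x - P.ξ y)‖ₑ * (‖d x - d y‖ₑ * ‖g y‖ₑ) := by rw [enorm_mul]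
    _ ≤ ‖η.toFun (P.ξ x - P.ξ y)‖ₑ * (L * ‖P.ξ x - P.ξ y‖ₑ * ‖g y‖ₑ) := by gcongr
    _ = _ := by ring

variable {F : Type*} [NormedAddCommGroup F] [NormedSpace ℂ F]
  {S : M → Type*} [TopologicalSpace (TotalSpace F S)]
  [∀ p, NormedAddCommGroup (S p)] [∀ p, InnerProductSpace ℂ (S p)]
  [FiberBundle F S] [VectorBundle ℂ F S] [IsSmoothHermitian n F S] [SecondCountableTopology M]

/-- The Schur test in weak form. The constant `B` is chosen before the kernel `κ`, so only the
integral of `κ` matters along a sequence of mollifiers. -/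
theorem exists_norm_integral_le (s : testSections n F S) {t : testSections n F S}
    (ht : ∀ x ∉ P.K, t.1 x = 0) : ∃ B : ℝ, 0 ≤ B ∧
      ∀ (κ : EuclideanSpace ℝ (Fin n) → ENNReal) (c : ℝ), Measurable κ → 0 ≤ c →
      ∫⁻ z, κ z ≤ ENNReal.ofReal c → ∀ (φ ψ : testSections n F S) (R : M → ℂ),
      (∀ x ∈ P.K, ‖R x‖ₑ ≤
        ∫⁻ y in P.K, κ (P.ξ x - P.ξ y) * ‖inner ℂ (s.1 y) (ψ.1 y)‖ₑ ∂μ) →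
      ‖∫ x, inner ℂ (φ.1 x) (t.1 x) * R x ∂μ‖ ≤ B * c * (normSq μ φ + normSq μ ψ) := by
  have := isLocallyFiniteMeasure n μ
  obtain ⟨bs, hbs, hs'⟩ := exists_norm_le s
  obtain ⟨bt, hbt, ht'⟩ := exists_norm_le t
  refine ⟨P.C * (bt ^ 2 + bs ^ 2), by positivity, fun κ c hκ hc hκc φ ψ R hR => ?_⟩
  have hφ := normSq_nonneg μ φ
  have hψ := normSq_nonneg μ ψ
  refine le_trans ?_ (show P.C * c * (bt ^ 2 * normSq μ φ + bs ^ 2 * normSq μ ψ) ≤ _ from ?_)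
  swap
  · have : P.C * (bt ^ 2 + bs ^ 2) * c * (normSq μ φ + normSq μ ψ) =
        P.C * c * (bt ^ 2 * normSq μ φ + bs ^ 2 * normSq μ ψ) +
        P.C * c * (bt ^ 2 * normSq μ ψ + bs ^ 2 * normSq μ φ) := by ring
    rw [this]
    exact le_add_of_nonneg_right (by positivity)
  have hnn : 0 ≤ P.C * c * (bt ^ 2 * normSq μ φ + bs ^ 2 * normSq μ ψ) := by positivity
  rw [← toReal_enorm]
  refine ENNReal.toReal_le_of_le_ofReal hnn ?_
  rw [← setIntegral_eq_integral_of_forall_compl_eq_zero (s := P.K)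
    (fun x hx => by rw [ht x hx, inner_zero_right, zero_mul])]
  calc ‖∫ x in P.K, inner ℂ (φ.1 x) (t.1 x) * R x ∂μ‖ₑ
      ≤ ∫⁻ x in P.K, ‖inner ℂ (φ.1 x) (t.1 x)‖ₑ *
          ∫⁻ y in P.K, κ (P.ξ x - P.ξ y) * ‖inner ℂ (s.1 y) (ψ.1 y)‖ₑ ∂μ ∂μ := by
        refine (enorm_integral_le_lintegral_enorm _).trans ?_
        refine setLIntegral_mono' P.isCompact.measurableSet fun x hx => ?_
        rw [enorm_mul]
        gcongr
        exact hR x hx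
    _ ≤ P.C * (∫⁻ z, κ z) * (∫⁻ x in P.K, ‖inner ℂ (φ.1 x) (t.1 x)‖ₑ ^ 2 ∂μ +
          ∫⁻ x in P.K, ‖inner ℂ (s.1 x) (ψ.1 x)‖ₑ ^ 2 ∂μ) :=
        P.lintegral_schur hκ (continuous_inner_sections φ t).measurable.enorm
          (continuous_inner_sections s ψ).measurable.enorm
    _ ≤ P.C * ENNReal.ofReal c * (ENNReal.ofReal (bt ^ 2 * normSq μ φ) +
          ENNReal.ofReal (bs ^ 2 * normSq μ ψ)) := by
        gcongr
        · exact (setLIntegral_le_lintegral _ _).trans (lintegral_enorm_inner_sq_le μ hbt ht' φ)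
        · refine (setLIntegral_le_lintegral _ _).trans
            (le_trans (lintegral_mono fun x => ?_) (lintegral_enorm_inner_sq_le μ hbs hs' ψ))
          rw [← ofReal_norm, norm_inner_symm, ofReal_norm]
    _ = _ := by
        rw [← ENNReal.ofReal_add (by positivity) (by positivity), ← ENNReal.ofReal_coe_nnreal,
          ← ENNReal.ofReal_mul P.C.coe_nonneg, ← ENNReal.ofReal_mul (by positivity)]

end Patch

/-! ### Rescaled mollifiers -/

namespace TestFun

open Filter

variable {n : ℕ}

theorem continuous (η : TestFun n) : Continuous η.toFun := η.contDiff.continuous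

/-- The rescaled functions `z ↦ (m + 1) ^ n * η ((m + 1) • z)`. -/
def scale (η : TestFun n) (m : ℕ) : TestFun n where
  toFun z := ((m : ℝ) + 1) ^ n * η.toFun (((m : ℝ) + 1) • z)
  contDiff := contDiff_const.mul (η.contDiff.comp (contDiff_const_smul _))
  hasCompactSupport := (η.hasCompactSupport.comp_smul (by positivity)).mul_left

theorem lintegral_scale (m : ℕ) {κ : EuclideanSpace ℝ (Fin n) → ENNReal} (hκ : Measurable κ) :
    ∫⁻ z, ENNReal.ofReal (((m : ℝ) + 1) ^ n) * κ (((m : ℝ) + 1) • z) = ∫⁻ z, κ z := by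
  have hr : (0 : ℝ) < (m : ℝ) + 1 := by positivity
  rw [lintegral_const_mul' _ _ ENNReal.ofReal_ne_top,
    ← lintegral_map hκ (measurable_const_smul ((m : ℝ) + 1)),
    Measure.map_addHaar_smul volume hr.ne', lintegral_smul_measure, smul_eq_mul, ← mul_assoc,
    finrank_euclideanSpace_fin, abs_of_pos (by positivity),
    ← ENNReal.ofReal_mul (by positivity), mul_inv_cancel₀ (by positivity), ENNReal.ofReal_one,
    one_mul]

theorem lintegral_enorm_scale (η : TestFun n) (m : ℕ) :
    ∫⁻ z, ‖(η.scale m).toFun z‖ₑ = ∫⁻ z, ‖η.toFun z‖ₑ := by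
  rw [← lintegral_scale m η.continuous.measurable.enorm]
  refine lintegral_congr fun z => ?_
  rw [scale, enorm_mul, Real.enorm_of_nonneg (by positivity)]

theorem pderiv_scale (η : TestFun n) (m : ℕ) (j : Fin n) (z : EuclideanSpace ℝ (Fin n)) :
    ((η.scale m).pderiv j).toFun z =
      ((m : ℝ) + 1) ^ n * (((m : ℝ) + 1) * (η.pderiv j).toFun (((m : ℝ) + 1) • z)) := by
  have h1 : HasFDerivAt η.toFun _ (((m : ℝ) + 1) • z) :=
    (η.contDiff.differentiable (by simp) _).hasFDerivAt
  have h2 : HasFDerivAt (η.scale m).toFun _ z :=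
    (h1.comp z ((hasFDerivAt_id z).const_smul ((m : ℝ) + 1))).const_mul (((m : ℝ) + 1) ^ n)
  simp only [pderiv]
  rw [h2.fderiv]
  simp

/-- Differentiating the rescaled function produces a factor `m + 1`, and this is exactly what turns
`‖z‖` into `‖(m + 1) • z‖`. The commutator bounds are uniform in `m` for this reason. -/
theorem lintegral_enorm_pderiv_scale (η : TestFun n) (m : ℕ) (j : Fin n) :
    ∫⁻ z, ‖((η.scale m).pderiv j).toFun z‖ₑ * ‖z‖ₑ = ∫⁻ z, ‖(η.pderiv j).toFun z‖ₑ * ‖z‖ₑ := by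
  rw [← lintegral_scale m (κ := fun z => ‖(η.pderiv j).toFun z‖ₑ * ‖z‖ₑ)
    ((η.pderiv j).continuous.measurable.enorm.mul measurable_enorm)]
  refine lintegral_congr fun z => ?_
  rw [pderiv_scale, enorm_mul, enorm_mul, enorm_smul,
    Real.enorm_of_nonneg (show (0 : ℝ) ≤ ((m : ℝ) + 1) ^ n by positivity)]
  ring

theorem exists_lintegral_enorm_le (η : TestFun n) :
    ∃ c : ℝ, 0 ≤ c ∧ ∫⁻ z, ‖η.toFun z‖ₑ ≤ ENNReal.ofReal c := by
  have hi : Integrable η.toFun := η.continuous.integrable_of_hasCompactSupport η.hasCompactSupport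
  exact ⟨_, ENNReal.toReal_nonneg, (ENNReal.ofReal_toReal hi.2.ne).ge⟩

theorem exists_lintegral_enorm_mul_le (η : TestFun n) :
    ∃ c : ℝ, 0 ≤ c ∧ ∫⁻ z, ‖η.toFun z‖ₑ * ‖z‖ₑ ≤ ENNReal.ofReal c := by
  have hi : Integrable fun z => η.toFun z * ‖z‖ :=
    (η.continuous.mul continuous_norm).integrable_of_hasCompactSupport
      η.hasCompactSupport.mul_right
  have h : ∫⁻ z, ‖η.toFun z * ‖z‖‖ₑ = ∫⁻ z, ‖η.toFun z‖ₑ * ‖z‖ₑ := by simp only [enorm_mul, enorm_norm]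
  exact ⟨_, ENNReal.toReal_nonneg, (h ▸ (ENNReal.ofReal_toReal hi.2.ne).ge :)⟩

/-- A mollifier: a nonnegative function with integral one, supported in the unit ball. -/
structure IsMollifier (η : TestFun n) : Prop where
  nonneg : ∀ z, 0 ≤ η.toFun z
  integral_eq_one : ∫ z, η.toFun z = 1
  support_subset : Function.support η.toFun ⊆ Metric.ball 0 1

theorem exists_isMollifier (n : ℕ) : ∃ η : TestFun n, η.IsMollifier := by
  let f : ContDiffBump (0 : EuclideanSpace ℝ (Fin n)) := ⟨1 / 2, 1, by norm_num, by norm_num⟩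
  refine ⟨⟨f.normed volume, f.contDiff_normed, f.hasCompactSupport_normed⟩, f.nonneg_normed,
    f.integral_normed, ?_⟩
  rw [f.support_normed_eq]

theorem IsMollifier.integral_scale {η : TestFun n} (hη : η.IsMollifier) (m : ℕ) :
    ∫ z, (η.scale m).toFun z = 1 := by
  have hr : (0 : ℝ) < (m : ℝ) + 1 := by positivity
  simp only [scale]
  rw [integral_const_mul, Measure.integral_comp_smul volume η.toFun, hη.integral_eq_one,
    finrank_euclideanSpace_fin, abs_of_pos (by positivity), smul_eq_mul, mul_one,
    mul_inv_cancel₀ (by positivity)]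

theorem IsMollifier.support_scale {η : TestFun n} (hη : η.IsMollifier) (m : ℕ) :
    Function.support (η.scale m).toFun ⊆ Metric.ball 0 (1 / ((m : ℝ) + 1)) := by
  intro z hz
  have hr : (0 : ℝ) < (m : ℝ) + 1 := by positivity
  have h1 : η.toFun (((m : ℝ) + 1) • z) ≠ 0 := fun h => hz (by simp [scale, h])
  have h2 := hη.support_subset h1
  rw [mem_ball_zero_iff, norm_smul, Real.norm_of_nonneg hr.le] at h2
  rwa [mem_ball_zero_iff, lt_div_iff₀ hr, mul_comm]

end TestFun

/-! ### Convergence and bounds of the regularizing operators -/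

namespace Patch

open Filter

variable {n : ℕ} {M : Type*} [TopologicalSpace M] [ChartedSpace (EuclideanSpace ℝ (Fin n)) M]
  [MeasurableSpace M] {μ : Measure M} (P : Patch n μ)

/-- Integration is against `μ`, not Lebesgue measure, which is why the limit carries the density.
The transferred function `G` is uniformly continuous, and the mollifiers are supported in shrinking
balls. -/
theorem tendstoUniformlyOn_mollify {η : TestFun n} (hη : η.IsMollifier) {g : M → ℂ}
    (hg : Continuous g) (hgK : ∀ x ∉ P.K, g x = 0) :
    TendstoUniformlyOn (fun m => P.mollify (η.scale m) g) (fun x => P.dens x • g x) atTop P.K := by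
  obtain ⟨G, hGc, hGs, hGK, hG⟩ := P.transfer g hg hgK
  have huc : UniformContinuous G := hGs.uniformContinuous_of_continuous hGc
  rw [Metric.tendstoUniformlyOn_iff]
  intro ε hε
  obtain ⟨δ, hδ, hδG⟩ := Metric.uniformContinuous_iff.1 huc (ε / 2) (by positivity)
  obtain ⟨N, hN⟩ := exists_nat_one_div_lt hδ
  filter_upwards [eventually_ge_atTop N] with m hm x hx
  have hconv : P.mollify (η.scale m) g x =
      convolution (η.scale m).toFun G (ContinuousLinearMap.lsmul ℝ ℝ) volume (P.ξ x) := by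
    rw [mollify, hG (fun z => (η.scale m).toFun (P.ξ x - z))
      ((η.scale m).continuous.comp (continuous_const.sub continuous_id)), convolution_def,
      ← integral_sub_left_eq_self _ volume (P.ξ x)]
    simp
  rw [hconv, ← hGK x hx, dist_comm]
  refine (dist_convolution_le (R := 1 / ((m : ℝ) + 1)) (half_pos hε).le (hη.support_scale m)
    (fun z => mul_nonneg (by positivity) (hη.nonneg _)) (hη.integral_scale m)
    hGc.aestronglyMeasurable fun z hz => ?_).trans_lt (half_lt_self hε)
  refine (hδG ?_).le
  refine (Metric.mem_ball.1 hz).trans_le (le_trans ?_ hN.le)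
  gcongr

variable [T2Space M] [BorelSpace M] [IsManifold (𝓡 n) ∞ M] [IsSmoothMeasure n μ]
  {F : Type*} [NormedAddCommGroup F] [NormedSpace ℂ F]
  {S : M → Type*} [TopologicalSpace (TotalSpace F S)]
  [∀ p, NormedAddCommGroup (S p)] [∀ p, InnerProductSpace ℂ (S p)]
  [FiberBundle F S] [VectorBundle ℂ F S] [IsSmoothHermitian n F S]
  {ι : Type*} [Fintype ι]

/-- The coefficients converge uniformly on `P.K`, the difference vanishes off `P.K`, and `P.K` has
finite measure. The assumption `hρ` identifies the limit. -/
theorem tendsto_normSq_regularize {η : TestFun n} (hη : η.IsMollifier)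
    (s t : ι → testSections n F S) (hs : ∀ a, ∀ x ∉ P.K, (s a).1 x = 0)
    (ht : ∀ a, ∀ x ∉ P.K, (t a).1 x = 0) (ρ : C^∞⟮𝓡 n, M; 𝓘(ℝ, ℂ), ℂ⟯) (ψ : testSections n F S)
    (hρ : ∀ x, ∑ a, (P.dens x • inner ℂ ((s a).1 x) (ψ.1 x)) • (t a).1 x = ρ x • ψ.1 x) :
    Tendsto (fun m => normSq μ (P.regularize (η.scale m) s t hs ψ - mulTest ρ ψ)) atTop
      (𝓝 0) := by
  have := isLocallyFiniteMeasure n μ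
  choose b hb hb' using fun a => exists_norm_le (t a)
  set B := ∑ a, b a
  have hB : 0 ≤ B := Finset.sum_nonneg fun a _ => hb a
  set V := μ.real P.K
  have hV : 0 ≤ V := measureReal_nonneg
  rw [Metric.tendsto_atTop]
  intro ε hε
  -- The squared norm will be at most `δ ^ 2 * B ^ 2 * V`. With `δ ≤ 1` this is less than `δ * (B ^
  -- 2 * V + 1) ≤ ε`, the `+ 1` giving strictness and a nonzero denominator.
  set δ := min 1 (ε / (B ^ 2 * V + 1)) with hδ
  have hδ0 : 0 < δ := lt_min one_pos (by positivity)
  have hδ1 : δ ≤ 1 := min_le_left _ _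
  have hδ2 : δ * (B ^ 2 * V + 1) ≤ ε := by
    rw [← le_div_iff₀ (by positivity)]
    exact min_le_right _ _
  have hu : ∀ᶠ m in atTop, ∀ a, ∀ x ∈ P.K, dist (P.dens x • inner ℂ ((s a).1 x) (ψ.1 x))
      (P.mollify (η.scale m) (fun y => inner ℂ ((s a).1 y) (ψ.1 y)) x) < δ :=
    eventually_all.2 fun a => Metric.tendstoUniformlyOn_iff.1 (P.tendstoUniformlyOn_mollify hη
      (continuous_inner_sections (s a) ψ) (P.inner_left_eq_zero (hs a) ψ.1)) δ hδ0
  obtain ⟨N, hN⟩ := eventually_atTop.1 hu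
  refine ⟨N, fun m hm => ?_⟩
  set w := P.regularize (η.scale m) s t hs ψ - mulTest ρ ψ with hw
  have hwx : ∀ x, w.1 x = ∑ a, (P.mollify (η.scale m) (fun y => inner ℂ ((s a).1 y) (ψ.1 y)) x -
      P.dens x • inner ℂ ((s a).1 x) (ψ.1 x)) • (t a).1 x := fun x => by
    simp only [sub_smul, Finset.sum_sub_distrib, hρ, ← P.regularize_apply _ s t hs]
    rfl
  have hwK : ∀ x ∉ P.K, w.1 x = 0 := fun x hx => by
    rw [hwx]
    exact Finset.sum_eq_zero fun a _ => by rw [ht a x hx, smul_zero]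
  have hwn : ∀ x ∈ P.K, ‖w.1 x‖ ≤ δ * B := fun x hx => by
    rw [hwx, Finset.mul_sum]
    refine (norm_sum_le _ _).trans (Finset.sum_le_sum fun a _ => ?_)
    rw [norm_smul]
    refine mul_le_mul ?_ (hb' a x) (norm_nonneg _) hδ0.le
    rw [← dist_eq_norm, dist_comm]
    exact (hN m hm a x hx).le
  have hle : normSq μ w ≤ (δ * B) ^ 2 * V := by
    rw [normSq, ← setIntegral_eq_integral_of_forall_compl_eq_zero (s := P.K)
      (fun x hx => by rw [hwK x hx, norm_zero, zero_pow two_ne_zero])]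
    refine (Real.le_norm_self _).trans (norm_setIntegral_le_of_norm_le_const
      P.isCompact.measure_lt_top fun x hx => ?_)
    rw [norm_pow, norm_norm]
    exact pow_le_pow_left₀ (norm_nonneg _) (hwn x hx) 2
  rw [Real.dist_0_eq_abs, abs_of_nonneg (normSq_nonneg μ w)]
  refine hle.trans_lt (lt_of_lt_of_le ?_ hδ2)
  have h1 : (δ * B) ^ 2 * V = δ * (δ * (B ^ 2 * V)) := by ring
  rw [h1]
  refine mul_lt_mul_of_pos_left ?_ hδ0
  have h2 : δ * (B ^ 2 * V) ≤ 1 * (B ^ 2 * V) := mul_le_mul_of_nonneg_right hδ1 (by positivity)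
  linarith

variable [SecondCountableTopology M]

/-- The index type is arbitrary so that terms of different kinds can be treated together, indexed by
a sum type. -/
theorem exists_norm_integral_inner_le {κ : Type*} [Fintype κ] (s t : κ → testSections n F S)
    (ht : ∀ a, ∀ x ∉ P.K, (t a).1 x = 0) : ∃ B : ℝ, 0 ≤ B ∧
      ∀ (k : κ → EuclideanSpace ℝ (Fin n) → ENNReal) (c : ℝ), (∀ a, Measurable (k a)) → 0 ≤ c →
      (∀ a, ∫⁻ z, k a z ≤ ENNReal.ofReal c) → ∀ (φ ψ : testSections n F S) (w : ∀ p, S p)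
      (g : κ → M → ℂ), (∀ a, Continuous (g a)) →
      (∀ a, ∀ x ∈ P.K, ‖g a x‖ₑ ≤
        ∫⁻ y in P.K, k a (P.ξ x - P.ξ y) * ‖inner ℂ ((s a).1 y) (ψ.1 y)‖ₑ ∂μ) →
      (∀ x, w x = ∑ a, g a x • (t a).1 x) →
      ‖∫ x, inner ℂ (φ.1 x) (w x) ∂μ‖ ≤ B * c * (normSq μ φ + normSq μ ψ) := by
  choose B hB hB' using fun a => P.exists_norm_integral_le (s a) (ht a)
  refine ⟨∑ a, B a, Finset.sum_nonneg fun a _ => hB a,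
    fun k c hk hc hkc φ ψ w g hg hgk hw => ?_⟩
  simp only [hw]
  rw [integral_inner_sum_smul φ _ hg t, Finset.sum_mul, Finset.sum_mul]
  exact (norm_sum_le _ _).trans (Finset.sum_le_sum fun a _ =>
    hB' a (k a) c (hk a) hc (hkc a) φ ψ (g a) (hgk a))

theorem exists_norm_integral_regularize_le (s t : ι → testSections n F S)
    (hs : ∀ a, ∀ x ∉ P.K, (s a).1 x = 0) (ht : ∀ a, ∀ x ∉ P.K, (t a).1 x = 0) :
    ∃ B : ℝ, 0 ≤ B ∧ ∀ (η : TestFun n) (c : ℝ), 0 ≤ c →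
      ∫⁻ z, ‖η.toFun z‖ₑ ≤ ENNReal.ofReal c → ∀ φ ψ : testSections n F S,
      ‖∫ x, inner ℂ (φ.1 x) ((P.regularize η s t hs ψ).1 x) ∂μ‖ ≤
        B * c * (normSq μ φ + normSq μ ψ) := by
  obtain ⟨B, hB, hB'⟩ := P.exists_norm_integral_inner_le s t ht
  refine ⟨B, hB, fun η c hc hη φ ψ => ?_⟩
  exact hB' (fun _ z => ‖η.toFun z‖ₑ) c (fun _ => η.continuous.measurable.enorm) hc (fun _ => hη)
    φ ψ _ _ (fun a => P.continuous_mollify η (continuous_inner_sections (s a) ψ)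
      (P.inner_left_eq_zero (hs a) ψ.1))
    (fun a x _ => P.enorm_mollify_le η (P.inner_left_eq_zero (hs a) ψ.1) x)
    (P.regularize_apply η s t hs ψ)

/-- All derivatives fall on the fixed sections `t` or on `η`. Here `B` may depend on `η`: only
boundedness for each single `m` is needed. -/
theorem exists_norm_integral_onTestSections_regularize_le (D : DifferentialOperator n F S)
    (s t : ι → testSections n F S) (hs : ∀ a, ∀ x ∉ P.K, (s a).1 x = 0)
    (ht : ∀ a, ∀ x ∉ P.K, (t a).1 x = 0) (η : TestFun n) :
    ∃ B : ℝ, 0 ≤ B ∧ ∀ φ ψ : testSections n F S,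
      ‖∫ x, inner ℂ (φ.1 x) ((D.onTestSections (P.regularize η s t hs ψ)).1 x) ∂μ‖ ≤
        B * (normSq μ φ + normSq μ ψ) := by
  obtain ⟨B, hB, hB'⟩ := P.exists_norm_integral_inner_le (κ := ι ⊕ ι × Fin n)
    (Sum.elim s fun q => s q.1)
    (Sum.elim (fun a => D.onTestSections (t a)) fun q => D.commTest (coordFn P.ξ q.2) (t q.1)) (by
      rintro (a | ⟨a, j⟩) x hx
      · exact D.onTestSections_eq_zero P.isCompact.isClosed (ht a) hx
      · exact D.commTest_eq_zero _ (ht a x hx))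
  obtain ⟨c₀, hc₀, hη₀⟩ := η.exists_lintegral_enorm_le
  choose c hc hc' using fun j => (η.pderiv j).exists_lintegral_enorm_le
  have hcs : 0 ≤ ∑ j, c j := Finset.sum_nonneg fun j _ => hc j
  have hcj : ∀ j, c j ≤ ∑ j, c j := fun j =>
    Finset.single_le_sum (fun b _ => hc b) (Finset.mem_univ j)
  have hz : ∀ (ψ : testSections n F S) a, ∀ x ∉ P.K, inner ℂ ((s a).1 x) (ψ.1 x) = 0 :=
    fun ψ a => P.inner_left_eq_zero (hs a) ψ.1
  refine ⟨B * (c₀ + ∑ j, c j), by positivity, fun φ ψ => ?_⟩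
  refine hB' (Sum.elim (fun _ z => ‖η.toFun z‖ₑ) fun q z => ‖(η.pderiv q.2).toFun z‖ₑ)
    (c₀ + ∑ j, c j) ?_ (by positivity) ?_ φ ψ _
    (Sum.elim (fun a => P.mollify η fun y => inner ℂ ((s a).1 y) (ψ.1 y))
      fun q => P.mollify (η.pderiv q.2) fun y => inner ℂ ((s q.1).1 y) (ψ.1 y)) ?_ ?_ fun x => ?_
  · rintro (a | ⟨a, j⟩)
    · exact η.continuous.measurable.enorm
    · exact (η.pderiv j).continuous.measurable.enorm
  · rintro (a | ⟨a, j⟩)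
    · exact hη₀.trans (ENNReal.ofReal_le_ofReal (by linarith))
    · exact (hc' j).trans (ENNReal.ofReal_le_ofReal (by linarith [hcj j]))
  · rintro (a | ⟨a, j⟩)
    · exact P.continuous_mollify η (continuous_inner_sections (s a) ψ) (hz ψ a)
    · exact P.continuous_mollify _ (continuous_inner_sections (s a) ψ) (hz ψ a)
  · rintro (a | ⟨a, j⟩) x hx
    · exact P.enorm_mollify_le η (hz ψ a) x
    · exact P.enorm_mollify_le _ (hz ψ a) x
  · rw [P.onTestSections_regularize D η s t hs ψ x, Fintype.sum_sum_type, Fintype.sum_prod_type]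
    simp only [Sum.elim_inl, Sum.elim_inr]

/-- Here `B` must not depend on `η`. The derivatives of `η` are measured only after weighting by
`‖z‖`, the one quantity that stays bounded under rescaling. -/
theorem exists_norm_integral_commutator_le {D : DifferentialOperator n F S}
    (hD : D.IsFormallySymmetric μ) (s t : ι → testSections n F S)
    (hs : ∀ a, ∀ x ∉ P.K, (s a).1 x = 0) (ht : ∀ a, ∀ x ∉ P.K, (t a).1 x = 0)
    (d : Fin n → ι → ι → M → ℂ) (hd : ∀ j a b, Continuous (d j a b)) {L : NNReal}
    (hL : ∀ j a b, ∀ x ∈ P.K, ∀ y ∈ P.K, ‖d j a b x - d j a b y‖ ≤ L * ‖P.ξ x - P.ξ y‖)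
    (hdt : ∀ j a x, (D.commTest (coordFn P.ξ j) (t a)).1 x = ∑ b, d j a b x • (t b).1 x)
    (hds : ∀ j a x, (D.commTest (coordFn P.ξ j) (s a)).1 x =
      -∑ b, conj (d j b a x) • (s b).1 x) :
    ∃ B : ℝ, 0 ≤ B ∧ ∀ (η : TestFun n) (c : ℝ), 0 ≤ c →
      ∫⁻ z, ‖η.toFun z‖ₑ ≤ ENNReal.ofReal c →
      (∀ j, ∫⁻ z, ‖(η.pderiv j).toFun z‖ₑ * ‖z‖ₑ ≤ ENNReal.ofReal c) →
      ∀ φ ψ : testSections n F S,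
      ‖∫ x, inner ℂ (φ.1 x) ((D.onTestSections (P.regularize η s t hs ψ)).1 x -
        (P.regularize η s t hs (D.onTestSections ψ)).1 x) ∂μ‖ ≤
        B * c * (normSq μ φ + normSq μ ψ) := by
  have hDs : ∀ a, ∀ x ∉ P.K, (D.onTestSections (s a)).1 x = 0 := fun a x hx =>
    D.onTestSections_eq_zero P.isCompact.isClosed (hs a) hx
  -- The three summands index the terms of `commutator_regularize`: `D` on `t`, `D` on `s`, and the
  -- commutators of convolution with `d`.
  obtain ⟨B, hB, hB'⟩ := P.exists_norm_integral_inner_le (κ := ι ⊕ ι ⊕ ι × Fin n × ι)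
    (Sum.elim s (Sum.elim (fun a => D.onTestSections (s a)) fun q => s q.1))
    (Sum.elim (fun a => D.onTestSections (t a)) (Sum.elim t fun q => t q.2.2)) (by
      rintro (a | a | ⟨a, j, b⟩) x hx
      · exact D.onTestSections_eq_zero P.isCompact.isClosed (ht a) hx
      · exact ht a x hx
      · exact ht b x hx)
  -- The kernels have integral at most `c` or `L * c`, so `(1 + L) * c` covers both.
  refine ⟨B * (1 + L), by positivity, fun η c hc hη hη' φ ψ => ?_⟩
  have hz : ∀ a, ∀ x ∉ P.K, inner ℂ ((s a).1 x) (ψ.1 x) = 0 := fun a =>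
    P.inner_left_eq_zero (hs a) ψ.1
  have hcL : ENNReal.ofReal c ≤ ENNReal.ofReal ((1 + L) * c) :=
    ENNReal.ofReal_le_ofReal (le_mul_of_one_le_left hc (by simp))
  rw [mul_assoc B]
  refine hB' (Sum.elim (fun _ z => ‖η.toFun z‖ₑ) (Sum.elim (fun _ z => ‖η.toFun z‖ₑ)
      fun q z => L * (‖(η.pderiv q.2.1).toFun z‖ₑ * ‖z‖ₑ))) ((1 + L) * c) ?_ (by positivity) ?_ φ ψ _
    (Sum.elim (fun a => P.mollify η fun y => inner ℂ ((s a).1 y) (ψ.1 y))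
      (Sum.elim (fun a x => -P.mollify η (fun y =>
          inner ℂ ((D.onTestSections (s a)).1 y) (ψ.1 y)) x)
        fun q x => d q.2.1 q.1 q.2.2 x *
          P.mollify (η.pderiv q.2.1) (fun y => inner ℂ ((s q.1).1 y) (ψ.1 y)) x -
        P.mollify (η.pderiv q.2.1)
          (fun y => d q.2.1 q.1 q.2.2 y * inner ℂ ((s q.1).1 y) (ψ.1 y)) x)) ?_ ?_ fun x => ?_
  · rintro (a | a | ⟨a, j, b⟩)
    · exact η.continuous.measurable.enorm
    · exact η.continuous.measurable.enorm
    · exact ((η.pderiv j).continuous.measurable.enorm.mul measurable_enorm).const_mul _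
  · rintro (a | a | ⟨a, j, b⟩)
    · exact hη.trans hcL
    · exact hη.trans hcL
    · simp only [Sum.elim_inr]
      rw [lintegral_const_mul' _ _ ENNReal.coe_ne_top]
      calc (L : ENNReal) * ∫⁻ z, ‖(η.pderiv j).toFun z‖ₑ * ‖z‖ₑ
          ≤ L * ENNReal.ofReal c := by gcongr; exact hη' j
        _ = ENNReal.ofReal (L * c) := by
          rw [ENNReal.ofReal_mul L.coe_nonneg, ENNReal.ofReal_coe_nnreal]
        _ ≤ _ := ENNReal.ofReal_le_ofReal (by gcongr; simp)
  · rintro (a | a | ⟨a, j, b⟩)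
    · exact P.continuous_mollify η (continuous_inner_sections (s a) ψ) (hz a)
    · exact (P.continuous_mollify η (continuous_inner_sections _ ψ)
        (P.inner_left_eq_zero (hDs a) ψ.1)).neg
    · exact ((hd j a b).mul (P.continuous_mollify _ (continuous_inner_sections (s a) ψ) (hz a))).sub
        (P.continuous_mollify _ ((hd j a b).mul (continuous_inner_sections (s a) ψ))
          fun x hx => by rw [hz a x hx, mul_zero])
  · rintro (a | a | ⟨a, j, b⟩) x hx
    · exact P.enorm_mollify_le η (hz a) x
    · simp only [Sum.elim_inr, Sum.elim_inl, enorm_neg]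
      exact P.enorm_mollify_le η (P.inner_left_eq_zero (hDs a) ψ.1) x
    · exact P.enorm_mollify_commutator_le _ (continuous_inner_sections (s a) ψ) (hz a) (hd j a b)
        (hL j a b) hx
  · rw [P.commutator_regularize hD η s t hs d hd hdt hds ψ x, Fintype.sum_sum_type,
      Fintype.sum_sum_type]
    simp only [Sum.elim_inl, Sum.elim_inr, neg_smul, Finset.sum_neg_distrib]
    abel

end Patch

/-! ### Existence of coordinate patches -/

section Patches

open Filter

variable {n : ℕ} {M : Type*} [TopologicalSpace M] [ChartedSpace (EuclideanSpace ℝ (Fin n)) M]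

/-- A function which is smooth on an open set, cut off by a smooth function. -/
theorem contMDiff_smul_of_tsupport_subset {V : Type*} [NormedAddCommGroup V] [NormedSpace ℝ V]
    {χ : M → ℝ} (hχ : ContMDiff (𝓡 n) 𝓘(ℝ, ℝ) ∞ χ) {U : Set M} (hU : IsOpen U)
    (hχU : tsupport χ ⊆ U) {g : M → V} (hg : ContMDiffOn (𝓡 n) 𝓘(ℝ, V) ∞ g U) :
    ContMDiff (𝓡 n) 𝓘(ℝ, V) ∞ fun x => χ x • g x :=
  contMDiff_of_tsupport fun x hx =>
    (hχ x).smul (hg.contMDiffAt (hU.mem_nhds (hχU (tsupport_smul_subset_left χ g hx))))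

variable [IsManifold (𝓡 n) ∞ M]

/-- The chart target need not be convex, so a derivative bound there is not enough. Compact support
allows extension by zero to a smooth function on all of `ℝⁿ`, which is globally Lipschitz. -/
theorem exists_lipschitz_chart (x₀ : M) {d : M → ℂ} (hd : ContMDiff (𝓡 n) 𝓘(ℝ, ℂ) ∞ d)
    (hdc : HasCompactSupport d)
    (hds : tsupport d ⊆ (chartAt (EuclideanSpace ℝ (Fin n)) x₀).source) :
    ∃ L : NNReal, ∀ x ∈ (chartAt (EuclideanSpace ℝ (Fin n)) x₀).source,
      ∀ y ∈ (chartAt (EuclideanSpace ℝ (Fin n)) x₀).source, ‖d x - d y‖ ≤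
        L * ‖chartAt (EuclideanSpace ℝ (Fin n)) x₀ x - chartAt (EuclideanSpace ℝ (Fin n)) x₀ y‖ := by
  set φ := chartAt (EuclideanSpace ℝ (Fin n)) x₀ with hφ
  set G : EuclideanSpace ℝ (Fin n) → ℂ := φ.target.indicator fun w => d (φ.symm w) with hG
  have hcK : IsCompact (φ '' tsupport d) :=
    hdc.isCompact.image_of_continuousOn (φ.continuousOn.mono hds)
  have hKt : φ '' tsupport d ⊆ φ.target := by
    rintro _ ⟨x, hx, rfl⟩
    exact φ.map_source (hds hx)
  have hG0 : ∀ w ∉ φ '' tsupport d, G w = 0 := fun w hw => by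
    by_cases hwt : w ∈ φ.target
    · rw [hG, indicator_of_mem hwt]
      refine image_eq_zero_of_notMem_tsupport fun h => hw ⟨_, h, φ.right_inv hwt⟩
    · rw [hG, indicator_of_notMem hwt]
  have hsymm : ContMDiffOn (𝓡 n) (𝓡 n) ∞ φ.symm φ.target := contMDiffOn_chart_symm
  have hGt : ContDiffOn ℝ ∞ G φ.target :=
    contMDiffOn_iff_contDiffOn.1 ((hd.comp_contMDiffOn hsymm).congr
      fun w hw => indicator_of_mem hw _)
  have hGc : ContDiff ℝ ∞ G := by
    refine contDiff_iff_contDiffAt.2 fun w => ?_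
    by_cases hw : w ∈ φ '' tsupport d
    · exact hGt.contDiffAt (φ.open_target.mem_nhds (hKt hw))
    · refine (contDiffAt_const (c := (0 : ℂ))).congr_of_eventuallyEq ?_
      filter_upwards [hcK.isClosed.isOpen_compl.mem_nhds hw] with z hz
      exact hG0 z hz
  obtain ⟨L, hL⟩ := hGc.lipschitzWith_of_hasCompactSupport (HasCompactSupport.intro hcK hG0)
    (by simp)
  refine ⟨L, fun x hx y hy => ?_⟩
  have := hL.dist_le_mul (φ x) (φ y)
  rwa [dist_eq_norm, dist_eq_norm, hG, indicator_of_mem (φ.map_source hx),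
    indicator_of_mem (φ.map_source hy), φ.left_inv hx, φ.left_inv hy] at this

variable [T2Space M] [SecondCountableTopology M]

theorem exists_contMDiffMap_eq_one {K U : Set M} (hK : IsCompact K) (hU : IsOpen U) (hKU : K ⊆ U) :
    ∃ χ : C^∞⟮𝓡 n, M; 𝓘(ℝ, ℝ), ℝ⟯, (∀ x ∈ K, χ x = 1) ∧ HasCompactSupport χ ∧ tsupport χ ⊆ U := by
  have : LocallyCompactSpace M := ChartedSpace.locallyCompactSpace (EuclideanSpace ℝ (Fin n)) M
  obtain ⟨K', hK', hKK', hK'U⟩ := exists_compact_between hK hU hKU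
  obtain ⟨χ, h1, h0, -⟩ := exists_contMDiffMap_one_nhds_of_subset_interior (n := (⊤ : ℕ∞)) (𝓡 n)
    hK.isClosed hKK'
  have hs : tsupport χ ⊆ K' :=
    closure_minimal (fun x hx => by_contra fun h => hx (h0 x h)) hK'.isClosed
  exact ⟨χ, fun x hx => h1.self_of_nhdsSet x hx, hK'.of_isClosed_subset (isClosed_tsupport _) hs,
    hs.trans hK'U⟩

variable [MeasurableSpace M] [BorelSpace M] (μ : Measure M) [IsSmoothMeasure n μ]

/-- The chart is cut off to a global map `ξ` that is unchanged on `K`, and the density is read in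
the chart. As all functions to be mollified vanish off `K`, the values of `ξ` elsewhere do not
affect the integrals. -/
theorem exists_patch (x₀ : M) {K : Set M} (hK : IsCompact K)
    (hKs : K ⊆ (chartAt (EuclideanSpace ℝ (Fin n)) x₀).source) :
    ∃ P : Patch n μ, P.K = K ∧
      (∀ x ∈ K, P.ξ x = chartAt (EuclideanSpace ℝ (Fin n)) x₀ x) ∧
      ContMDiffOn (𝓡 n) 𝓘(ℝ, ℝ) ∞ P.dens (chartAt (EuclideanSpace ℝ (Fin n)) x₀).source ∧
      ∀ x ∈ (chartAt (EuclideanSpace ℝ (Fin n)) x₀).source, 0 < P.dens x := by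
  set φ := chartAt (EuclideanSpace ℝ (Fin n)) x₀ with hφ
  obtain ⟨f, hf, hpos, hmap⟩ := IsSmoothMeasure.exists_density (n := n) (μ := μ) φ
    (IsManifold.chart_mem_maximalAtlas x₀)
  obtain ⟨χ, hχ1, -, hχs⟩ := exists_contMDiffMap_eq_one (n := n) hK φ.open_source hKs
  have hφs : ContMDiffOn (𝓡 n) (𝓡 n) ∞ φ φ.source := contMDiffOn_chart
  let ξ : C^∞⟮𝓡 n, M; 𝓘(ℝ, EuclideanSpace ℝ (Fin n)), EuclideanSpace ℝ (Fin n)⟯ :=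
    ⟨fun x => χ x • φ x, contMDiff_smul_of_tsupport_subset χ.contMDiff φ.open_source hχs hφs⟩
  have hξ : ∀ x ∈ K, ξ x = φ x := fun x hx => by
    change χ x • φ x = φ x
    rw [hχ1 x hx, one_smul]
  have hφm : AEMeasurable φ (μ.restrict φ.source) :=
    φ.continuousOn.aemeasurable φ.open_source.measurableSet
  have hcK : IsCompact (φ '' K) := hK.image_of_continuousOn (φ.continuousOn.mono hKs)
  have hKt : φ '' K ⊆ φ.target := by
    rintro _ ⟨x, hx, rfl⟩
    exact φ.map_source (hKs hx)
  -- The density may be unbounded on the chart target, but not on the compact image of `K`. This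
  -- bound is the constant of the patch.
  obtain ⟨c, hc⟩ := hcK.exists_bound_of_continuousOn (hf.continuousOn.mono hKt)
  have hfa : AEMeasurable (fun x => ENNReal.ofReal (f x)) (volume.restrict φ.target) :=
    (hf.continuousOn.aemeasurable φ.open_target.measurableSet).ennreal_ofReal
  refine ⟨⟨ξ, K, hK, f ∘ φ, c.toNNReal, ?_, ?_⟩, rfl, hξ,
    hf.contMDiffOn.comp hφs fun x hx => φ.map_source hx, fun x hx => hpos _ (φ.map_source hx)⟩
  · refine Measure.le_iff.2 fun A hA => ?_
    have hB : MeasurableSet (A ∩ φ '' K) := hA.inter hcK.measurableSet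
    rw [Measure.map_apply ξ.contMDiff.continuous.measurable hA,
      Measure.restrict_apply (ξ.contMDiff.continuous.measurable hA)]
    calc μ (ξ ⁻¹' A ∩ K) ≤ μ.restrict φ.source (φ ⁻¹' (A ∩ φ '' K)) := by
          rw [Measure.restrict_apply₀' φ.open_source.measurableSet.nullMeasurableSet]
          refine measure_mono fun x hx => ⟨⟨?_, mem_image_of_mem _ hx.2⟩, hKs hx.2⟩
          have := hx.1
          rwa [mem_preimage, hξ x hx.2] at this
      _ = ∫⁻ z in A ∩ φ '' K, ENNReal.ofReal (f z) ∂volume.restrict φ.target := by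
          rw [← Measure.map_apply_of_aemeasurable hφm hB, hmap, withDensity_apply _ hB]
      _ ≤ ∫⁻ _ in A ∩ φ '' K, (c.toNNReal : ENNReal) ∂volume.restrict φ.target :=
          setLIntegral_mono' hB fun z hz => ENNReal.ofReal_le_ofReal
            ((le_abs_self _).trans (hc z hz.2))
      _ ≤ c.toNNReal * volume A := by
          rw [setLIntegral_const]
          exact mul_le_mul_right ((Measure.restrict_apply_le _ _).trans
            (measure_mono inter_subset_left)) _
      _ = _ := rfl
  · intro g hg hgK
    -- The extension by zero is continuous because it already vanishes off the compact set `φ '' K`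
    -- inside the target.
    set G : EuclideanSpace ℝ (Fin n) → ℂ := φ.target.indicator fun w => f w • g (φ.symm w) with hG
    have hG0 : ∀ w ∉ φ '' K, G w = 0 := fun w hw => by
      by_cases hwt : w ∈ φ.target
      · rw [hG, indicator_of_mem hwt, hgK, smul_zero]
        exact fun h => hw ⟨_, h, φ.right_inv hwt⟩
      · rw [hG, indicator_of_notMem hwt]
    have hGt : ContinuousOn G φ.target :=
      (hf.continuousOn.smul (hg.comp_continuousOn φ.symm.continuousOn)).congr
        fun w hw => indicator_of_mem hw _
    have hGc : Continuous G := by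
      refine continuous_iff_continuousAt.2 fun w => ?_
      by_cases hw : w ∈ φ '' K
      · exact hGt.continuousAt (φ.open_target.mem_nhds (hKt hw))
      · refine continuousAt_const (y := (0 : ℂ)).congr ?_
        filter_upwards [hcK.isClosed.isOpen_compl.mem_nhds hw] with z hz
        exact (hG0 z hz).symm
    refine ⟨G, hGc, HasCompactSupport.intro hcK hG0, fun x hx => ?_, fun h hh => ?_⟩
    · rw [hξ x hx, hG, indicator_of_mem (φ.map_source (hKs hx)), φ.left_inv (hKs hx)]
      rfl
    · have h1 : ∫ y, h (ξ y) • g y ∂μ =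
          ∫ y in φ.source, (fun w => h w • g (φ.symm w)) (φ y) ∂μ := by
        rw [← setIntegral_eq_integral_of_forall_compl_eq_zero (s := φ.source)
          (fun y hy => by rw [hgK y fun h => hy (hKs h), smul_zero])]
        refine setIntegral_congr_fun φ.open_source.measurableSet fun y hy => ?_
        simp only [φ.left_inv hy]
        by_cases hyK : y ∈ K
        · rw [hξ y hyK]
        · rw [hgK y hyK, smul_zero, smul_zero]
      have hΦ : AEStronglyMeasurable (fun w => h w • g (φ.symm w)) (volume.restrict φ.target) :=
        (hh.continuousOn.smul (hg.comp_continuousOn φ.symm.continuousOn)).aestronglyMeasurable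
          φ.open_target.measurableSet
      have h2 : AEStronglyMeasurable (fun w => h w • g (φ.symm w))
          ((μ.restrict φ.source).map φ) := by
        rw [hmap]
        exact hΦ.mono_ac (withDensity_absolutelyContinuous _ _)
      rw [h1, ← integral_map hφm h2, hmap,
        integral_withDensity_eq_integral_toReal_smul₀ hfa
          (Eventually.of_forall fun _ => ENNReal.ofReal_lt_top),
        ← setIntegral_eq_integral_of_forall_compl_eq_zero (s := φ.target)
          (f := fun z => h z • G z) (fun z hz => by rw [hG, indicator_of_notMem hz, smul_zero])]
      refine setIntegral_congr_fun φ.open_target.measurableSet fun z hz => ?_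
      simp only [hG, indicator_of_mem hz, ENNReal.toReal_ofReal (hpos z hz).le]
      rw [smul_comm]

end Patches

/-! ### Dual frames -/

section Frames

variable {n : ℕ} {M : Type*} [TopologicalSpace M] [ChartedSpace (EuclideanSpace ℝ (Fin n)) M]

theorem contMDiff_det {ι : Type*} [Fintype ι] [DecidableEq ι] {G : M → Matrix ι ι ℂ}
    (hG : ∀ a b, ContMDiff (𝓡 n) 𝓘(ℝ, ℂ) ∞ fun x => G x a b) :
    ContMDiff (𝓡 n) 𝓘(ℝ, ℂ) ∞ fun x => (G x).det := by
  have h1 : ContDiff ℝ ∞ fun m : ι → ι → ℂ => (Matrix.of m).det := by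
    simp only [Matrix.det_apply]
    refine ContDiff.sum fun σ _ => ContDiff.const_smul _ (contDiff_prod fun i _ => ?_)
    exact contDiff_apply_apply ℝ ℂ _ _
  have h2 : ContMDiff (𝓡 n) 𝓘(ℝ, ι → ι → ℂ) ∞ fun x a b => G x a b :=
    contMDiff_pi_space.2 fun a => contMDiff_pi_space.2 fun b => hG a b
  exact h1.contMDiff.comp h2

/-- The inverse Gram matrix will be written as adjugate over determinant. The adjugate is smooth
everywhere, so invertibility matters only for the scalar `det⁻¹`. -/
theorem contMDiff_adjugate {ι : Type*} [Fintype ι] [DecidableEq ι] {G : M → Matrix ι ι ℂ}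
    (hG : ∀ a b, ContMDiff (𝓡 n) 𝓘(ℝ, ℂ) ∞ fun x => G x a b) (a b : ι) :
    ContMDiff (𝓡 n) 𝓘(ℝ, ℂ) ∞ fun x => (G x).adjugate a b := by
  simp only [Matrix.adjugate_apply]
  refine contMDiff_det fun i j => ?_
  simp only [Matrix.updateRow_apply]
  split_ifs
  · exact contMDiff_const
  · exact hG i j

variable [IsManifold (𝓡 n) ∞ M] [T2Space M] [SecondCountableTopology M]
  {F : Type*} [NormedAddCommGroup F] [NormedSpace ℂ F] [FiniteDimensional ℂ F]
  {S : M → Type*} [TopologicalSpace (TotalSpace F S)]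
  [∀ p, NormedAddCommGroup (S p)] [∀ p, InnerProductSpace ℂ (S p)]
  [FiberBundle F S] [VectorBundle ℂ F S] [ContMDiffVectorBundle ∞ F S (𝓡 n)]

/-- On a compact subset of the domain of a local trivialization there is a frame consisting of
smooth sections with compact support. -/
theorem exists_frame (e : Trivialization F (π F S)) [MemTrivializationAtlas e] {K U : Set M}
    (hK : IsCompact K) (hU : IsOpen U) (hKU : K ⊆ U) (hUe : U ⊆ e.baseSet) :
    ∃ T : Fin (Module.finrank ℂ F) → testSections n F S, (∀ a, sectionSupport (T a).1 ⊆ U) ∧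
      ∀ x ∈ K, ∃ B : Module.Basis (Fin (Module.finrank ℂ F)) ℂ (S x), ∀ a, (T a).1 x = B a := by
  obtain ⟨χ, hχ1, hχc, hχU⟩ := exists_contMDiffMap_eq_one (n := n) hK hU hKU
  let b := Module.finBasis ℂ F
  have hsupp : ∀ a, sectionSupport (fun x => χ x • e.symm x (b a)) ⊆ tsupport χ := fun a =>
    closure_mono fun x hx h0 => hx (by simp [h0])
  have hsm : ∀ a, ContMDiffOn (𝓡 n) ((𝓡 n).prod 𝓘(ℝ, F)) ∞
      (fun x => TotalSpace.mk' F x (e.symm x (b a))) e.baseSet := fun a => by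
    rw [e.contMDiffOn_section_baseSet_iff]
    refine (contMDiffOn_const (c := b a)).congr fun y hy => ?_
    rw [e.apply_mk_symm hy]
  refine ⟨fun a => ⟨fun x => χ x • e.symm x (b a), ?_, ?_⟩, fun a => (hsupp a).trans hχU,
    fun x hx => ?_⟩
  · exact ContMDiffOn.smul_section_of_tsupport χ.contMDiff.contMDiffOn hU hχU ((hsm a).mono hUe)
  · exact hχc.isCompact.of_isClosed_subset isClosed_closure (hsupp a)
  · have hxe : x ∈ e.baseSet := hUe (hKU hx)
    refine ⟨b.map (e.linearEquivAt ℂ x hxe).symm, fun a => ?_⟩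
    simp [hχ1 x hx]

variable [IsSmoothHermitian n F S]

/-- On a compact subset of the domain of a local trivialization there is a frame consisting of
smooth sections with compact support, together with its dual frame. -/
theorem exists_dual_frames (e : Trivialization F (π F S)) [MemTrivializationAtlas e] {K U : Set M}
    (hK : IsCompact K) (hU : IsOpen U) (hKU : K ⊆ U) (hUe : U ⊆ e.baseSet) :
    ∃ T Θ : Fin (Module.finrank ℂ F) → testSections n F S, (∀ a, sectionSupport (Θ a).1 ⊆ U) ∧
      (∀ x ∈ K, ∀ v : S x, ∑ a, inner ℂ ((Θ a).1 x) v • (T a).1 x = v) ∧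
      ∀ x ∈ K, ∀ v : S x, ∑ a, inner ℂ ((T a).1 x) v • (Θ a).1 x = v := by
  obtain ⟨χ, hχ1, hχc, hχU⟩ := exists_contMDiffMap_eq_one (n := n) hK hU hKU
  -- The frame is taken on all of `tsupport χ`, not only on `K`, so that the Gram matrix is
  -- invertible wherever the cut-off is nonzero.
  obtain ⟨T, hTU, hT⟩ := exists_frame (n := n) e hχc.isCompact hU hχU hUe
  set G : M → Matrix (Fin (Module.finrank ℂ F)) (Fin (Module.finrank ℂ F)) ℂ :=
    fun x => Matrix.gram ℂ fun a => (T a).1 x with hG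
  have hGs : ∀ a b, ContMDiff (𝓡 n) 𝓘(ℝ, ℂ) ∞ fun x => G x a b := fun a b =>
    IsSmoothHermitian.contMDiff_inner (n := n) (F := F) _ (T a).2.1 _ (T b).2.1
  have hdet : ∀ x ∈ tsupport χ, (G x).det ≠ 0 := fun x hx => by
    obtain ⟨B, hB⟩ := hT x hx
    rw [hG, Matrix.det_gram_ne_zero_iff_linearIndependent]
    simpa only [hB] using B.linearIndependent
  -- The dual frame has the inverse Gram matrix as coefficients, conjugated because they stand in
  -- the conjugate-linear argument of the inner product.
  have hc : ∀ a b, ContMDiff (𝓡 n) 𝓘(ℝ, ℂ) ∞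
      fun x => χ x • conj ((G x).det⁻¹ * (G x).adjugate a b) := fun a b =>
    contMDiff_of_tsupport fun x hx => by
      have hx' : (G x).det ≠ 0 := hdet x (tsupport_smul_subset_left χ _ hx)
      have h1 : ContDiffAt ℝ ∞ (fun q : ℂ × ℂ => conj (q.1⁻¹ * q.2))
          ((G x).det, (G x).adjugate a b) := by
        refine Complex.conjCLE.contDiff.contDiffAt.comp _ (ContDiffAt.mul ?_ contDiffAt_snd)
        exact ContDiffAt.comp _ (contDiffAt_inv ℝ hx') contDiffAt_fst
      have h2 : ContMDiffAt (𝓡 n) 𝓘(ℝ, ℂ) ∞ ((fun q : ℂ × ℂ => conj (q.1⁻¹ * q.2)) ∘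
          fun x => ((G x).det, (G x).adjugate a b)) x :=
        h1.contMDiffAt.comp x
          ((contMDiff_det hGs x).prodMk_space (contMDiff_adjugate hGs a b x))
      exact (χ.contMDiff x).smul h2
  let c : ∀ a b : Fin (Module.finrank ℂ F), C^∞⟮𝓡 n, M; 𝓘(ℝ, ℂ), ℂ⟯ := fun a b => ⟨_, hc a b⟩
  let Θ : Fin (Module.finrank ℂ F) → testSections n F S := fun a => ∑ b, mulTest (c a b) (T b)
  have hΘ : ∀ a x, (Θ a).1 x = ∑ b, c a b x • (T b).1 x := fun a x => by
    simp only [Θ, coe_sum_testSections, mulTest_apply]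
  have hc0 : ∀ a b, ∀ x ∉ tsupport χ, c a b x = 0 := fun a b x hx => by
    change χ x • _ = (0 : ℂ)
    rw [image_eq_zero_of_notMem_tsupport hx, zero_smul]
  have hdual : ∀ x ∈ K, ∀ a b, inner ℂ ((Θ a).1 x) ((T b).1 x) = if a = b then 1 else 0 := by
    intro x hx a b
    have hxχ : x ∈ tsupport χ := subset_tsupport _ (by simp [hχ1 x hx])
    have h1 : ∀ d, conj (c a d x) = (G x).det⁻¹ * (G x).adjugate a d := fun d => by
      have hcx : c a d x = χ x • conj ((G x).det⁻¹ * (G x).adjugate a d) := rfl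
      rw [hcx, hχ1 x hx, one_smul, Complex.conj_conj]
    have h2 : ((G x).adjugate * G x) a b = (G x).det * if a = b then 1 else 0 := by
      rw [Matrix.adjugate_mul, Matrix.smul_apply, Matrix.one_apply, smul_eq_mul]
    have h3 : inner ℂ ((Θ a).1 x) ((T b).1 x) = (G x).det⁻¹ * ((G x).adjugate * G x) a b := by
      rw [hΘ, sum_inner, Matrix.mul_apply, Finset.mul_sum]
      refine Finset.sum_congr rfl fun d _ => ?_
      rw [inner_smul_left, h1, mul_assoc]
      rfl
    rw [h3, h2, inv_mul_cancel_left₀ (hdet x hxχ)]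
  have hexp : ∀ x ∈ K, ∀ v : S x, ∑ a, inner ℂ ((Θ a).1 x) v • (T a).1 x = v := by
    intro x hx v
    obtain ⟨B, hB⟩ := hT x (subset_tsupport _ (by simp [hχ1 x hx]))
    have h1 : ∀ a, inner ℂ ((Θ a).1 x) v = B.repr v a := fun a => by
      conv_lhs => rw [← B.sum_repr v]
      simp only [inner_sum, inner_smul_right, ← hB, hdual x hx, mul_ite, mul_one, mul_zero,
        Finset.sum_ite_eq, Finset.mem_univ, if_true]
    simp only [h1, hB]
    exact B.sum_repr v
  refine ⟨T, Θ, fun a => ?_, hexp, fun x hx v => ?_⟩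
  · refine (closure_minimal (fun x hx => ?_) (isClosed_tsupport χ)).trans hχU
    by_contra h
    refine hx ?_
    rw [hΘ]
    exact Finset.sum_eq_zero fun b _ => by rw [hc0 a b x h, zero_smul]
  -- The second expansion is the adjoint of the first: pair with `w` and expand `w`.
  · refine ext_inner_right ℂ fun w => ?_
    conv_rhs => rw [← hexp x hx w]
    simp only [sum_inner, inner_sum, inner_smul_left, inner_smul_right, inner_conj_symm, mul_comm]

end Frames

/-! ### Regularizing sequences -/

section Regularizing

open Filter

theorem norm_sum_le_mul_norm {V : Type*} [SeminormedAddCommGroup V] {ι : Type*} [Fintype ι]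
    {f : ι → V} {C : ι → ℝ} {x : V}
    (h : ∀ i, ‖f i‖ ≤ C i * ‖x‖) : ‖∑ i, f i‖ ≤ (∑ i, C i) * ‖x‖ := by
  rw [Finset.sum_mul]
  exact norm_sum_le_of_le _ fun i _ => h i

variable {V : Type*} [NormedAddCommGroup V] [InnerProductSpace ℂ V]

/-- A sequence of bounded linear maps with formal adjoints which tends strongly to `A` and whose
commutators with `D` are uniformly bounded. -/
structure IsRegularizing (D : V →ₗ[ℂ] V) (J : ℕ → V →ₗ[ℂ] V) (A : V → V) : Prop where
  exists_adjoint : ∃ K : ℕ → V →ₗ[ℂ] V, ∀ m x y, inner ℂ x (J m y) = inner ℂ (K m x) y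
  exists_bound : ∃ C, ∀ m x, ‖J m x‖ ≤ C * ‖x‖
  exists_bound_comp : ∀ m, ∃ C, ∀ x, ‖D (J m x)‖ ≤ C * ‖x‖
  exists_bound_commutator : ∃ C, ∀ m x, ‖D (J m x) - J m (D x)‖ ≤ C * ‖x‖
  tendsto : ∀ x, Tendsto (fun m => J m x) atTop (𝓝 (A x))

theorem IsRegularizing.sum {ι : Type*} [Fintype ι] {D : V →ₗ[ℂ] V} {J : ι → ℕ → V →ₗ[ℂ] V}
    {A : ι → V → V} (h : ∀ i, IsRegularizing D (J i) (A i)) :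
    IsRegularizing D (fun m => ∑ i, J i m) fun x => ∑ i, A i x where
  exists_adjoint := by
    choose K hK using fun i => (h i).exists_adjoint
    refine ⟨fun m => ∑ i, K i m, fun m x y => ?_⟩
    simp only [LinearMap.sum_apply, inner_sum, sum_inner, hK]
  exists_bound := by
    choose C hC using fun i => (h i).exists_bound
    refine ⟨∑ i, C i, fun m x => ?_⟩
    rw [LinearMap.sum_apply]
    exact norm_sum_le_mul_norm fun i => hC i m x
  exists_bound_comp m := by
    choose C hC using fun i => (h i).exists_bound_comp m
    refine ⟨∑ i, C i, fun x => ?_⟩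
    rw [LinearMap.sum_apply, map_sum]
    exact norm_sum_le_mul_norm fun i => hC i x
  exists_bound_commutator := by
    choose C hC using fun i => (h i).exists_bound_commutator
    refine ⟨∑ i, C i, fun m x => ?_⟩
    rw [LinearMap.sum_apply, LinearMap.sum_apply, map_sum, ← Finset.sum_sub_distrib]
    exact norm_sum_le_mul_norm fun i => hC i m x
  tendsto x := by
    simp only [LinearMap.sum_apply]
    exact tendsto_finsetSum _ fun i _ => (h i).tendsto x

/-- The left side is homogeneous in `φ` and the right side is not, so a suitable multiple of `χ` as
`φ` balances the two squares. -/
theorem norm_le_of_norm_inner_le {ψ χ : V} {C : ℝ}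
    (h : ∀ φ : V, ‖inner ℂ φ χ‖ ≤ C * (‖φ‖ ^ 2 + ‖ψ‖ ^ 2)) : ‖χ‖ ≤ 2 * C * ‖ψ‖ := by
  rcases eq_or_ne ψ 0 with rfl | hψ
  · have hχ : ∀ r : ℝ, 0 < r → ‖χ‖ ^ 2 ≤ r * (C * ‖χ‖ ^ 2) := fun r hr => by
      have h1 := h ((r : ℂ) • χ)
      rw [inner_smul_left, inner_self_eq_norm_sq_to_K, norm_smul] at h1
      simp only [Complex.conj_ofReal, Complex.coe_algebraMap, norm_mul, norm_pow,
        Complex.norm_real, Real.norm_of_nonneg hr.le, norm_norm, norm_zero] at h1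
      have h2 : r * ‖χ‖ ^ 2 ≤ r * (r * (C * ‖χ‖ ^ 2)) := by nlinarith
      exact le_of_mul_le_mul_left h2 hr
    have h0 : ‖χ‖ ^ 2 ≤ 0 := by
      refine ge_of_tendsto (f := fun r : ℝ => r * (C * ‖χ‖ ^ 2)) (x := 𝓝[>] (0 : ℝ)) ?_
        (eventually_mem_nhdsWithin.mono fun r hr => hχ r hr)
      have : Tendsto (fun r : ℝ => r * (C * ‖χ‖ ^ 2)) (𝓝 0) (𝓝 (0 * (C * ‖χ‖ ^ 2))) :=
        tendsto_id.mul_const _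
      rw [zero_mul] at this
      exact this.mono_left nhdsWithin_le_nhds
    have : ‖χ‖ = 0 := by nlinarith [norm_nonneg χ]
    simp [this]
  · rcases eq_or_ne χ 0 with rfl | hχ
    · have h1 := (norm_nonneg _).trans (h 0)
      have h2 : 0 < ‖ψ‖ := norm_pos_iff.2 hψ
      have h3 : 0 ≤ C := by
        simp only [norm_zero, ne_eq, OfNat.ofNat_ne_zero, not_false_eq_true, zero_pow,
          zero_add] at h1
        exact nonneg_of_mul_nonneg_left h1 (by positivity)
      rw [norm_zero]
      positivity
    · have hψ' : 0 < ‖ψ‖ := norm_pos_iff.2 hψ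
      have hχ' : 0 < ‖χ‖ := norm_pos_iff.2 hχ
      -- This multiple of `χ` has norm `‖ψ‖`.
      have h1 := h (((‖ψ‖ / ‖χ‖ : ℝ) : ℂ) • χ)
      rw [inner_smul_left, inner_self_eq_norm_sq_to_K, norm_smul] at h1
      simp only [Complex.conj_ofReal, Complex.coe_algebraMap, norm_mul, norm_pow,
        Complex.norm_real, Real.norm_of_nonneg (div_pos hψ' hχ').le, norm_norm] at h1
      rw [div_mul_cancel₀ _ hχ'.ne'] at h1
      have h2 : ‖ψ‖ / ‖χ‖ * ‖χ‖ ^ 2 = ‖ψ‖ * ‖χ‖ := by field_simp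
      rw [h2] at h1
      refine le_of_mul_le_mul_left ?_ hψ'
      nlinarith

end Regularizing

/-! ### Regularizing sequences for differential operators -/

section LocalRegularizing

open Filter

variable {n : ℕ} {M : Type*} [TopologicalSpace M] [ChartedSpace (EuclideanSpace ℝ (Fin n)) M]

/-- A real-valued smooth function, regarded as a complex-valued function. -/
def complexify (g : C^∞⟮𝓡 n, M; 𝓘(ℝ, ℝ), ℝ⟯) : C^∞⟮𝓡 n, M; 𝓘(ℝ, ℂ), ℂ⟯ :=
  ⟨fun x => (g x : ℂ), Complex.ofRealCLM.contDiff.contMDiff.comp g.contMDiff⟩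

@[simp]
theorem complexify_apply (g : C^∞⟮𝓡 n, M; 𝓘(ℝ, ℝ), ℝ⟯) (x : M) : complexify g x = (g x : ℂ) := rfl

variable [T2Space M] [SecondCountableTopology M] [IsManifold (𝓡 n) ∞ M]
  [MeasurableSpace M] [BorelSpace M] {μ : Measure M} [IsSmoothMeasure n μ]
  {F : Type*} [NormedAddCommGroup F] [NormedSpace ℂ F]
  {S : M → Type*} [TopologicalSpace (TotalSpace F S)]
  [∀ p, NormedAddCommGroup (S p)] [∀ p, InnerProductSpace ℂ (S p)]
  [FiberBundle F S] [VectorBundle ℂ F S] [IsSmoothHermitian n F S]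

omit [T2Space M] [SecondCountableTopology M] in
theorem preL2_norm_sq (u : PreL2 n F S μ) : ‖u‖ ^ 2 = normSq μ u := by
  rw [← inner_self_eq_norm_sq (𝕜 := ℂ), preL2_inner_def,
    ← integral_re (integrable_inner_sections μ u u)]
  exact integral_congr_ae (Eventually.of_forall fun p => inner_self_eq_norm_sq (u.1 p))

/-- One mollifier is rescaled. Its integral and the weighted integrals of its derivatives are scale
invariant, so the bounds hold with constants taken from the unscaled function. -/
theorem DifferentialOperator.isRegularizing {D : DifferentialOperator n F S}
    (hD : D.IsFormallySymmetric μ) (P : Patch n μ) {ι : Type*} [Fintype ι]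
    (s t : ι → testSections n F S) (hs : ∀ a, ∀ x ∉ P.K, (s a).1 x = 0)
    (ht : ∀ a, ∀ x ∉ P.K, (t a).1 x = 0)
    (d : Fin n → ι → ι → M → ℂ) (hd : ∀ j a b, Continuous (d j a b)) {L : NNReal}
    (hL : ∀ j a b, ∀ x ∈ P.K, ∀ y ∈ P.K, ‖d j a b x - d j a b y‖ ≤ L * ‖P.ξ x - P.ξ y‖)
    (hdt : ∀ j a x, (D.commTest (coordFn P.ξ j) (t a)).1 x = ∑ b, d j a b x • (t b).1 x)
    (hds : ∀ j a x, (D.commTest (coordFn P.ξ j) (s a)).1 x =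
      -∑ b, conj (d j b a x) • (s b).1 x)
    (ρ : C^∞⟮𝓡 n, M; 𝓘(ℝ, ℂ), ℂ⟯)
    (hρ : ∀ (ψ : testSections n F S) x,
      ∑ a, (P.dens x • inner ℂ ((s a).1 x) (ψ.1 x)) • (t a).1 x = ρ x • ψ.1 x) :
    ∃ J, IsRegularizing (V := PreL2 n F S μ) D.onTestSections J (mulTest ρ) := by
  obtain ⟨η, hη⟩ := TestFun.exists_isMollifier n
  obtain ⟨c₀, hc₀, hηc⟩ := η.exists_lintegral_enorm_le
  choose c₁ hc₁ hηc₁ using fun j => (η.pderiv j).exists_lintegral_enorm_mul_le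
  have hsum : 0 ≤ ∑ j, c₁ j := Finset.sum_nonneg fun j _ => hc₁ j
  have hle : ∀ j, c₁ j ≤ c₀ + ∑ j, c₁ j := fun j =>
    (Finset.single_le_sum (fun j _ => hc₁ j) (Finset.mem_univ j)).trans (by linarith)
  obtain ⟨B₁, hB₁, h₁⟩ := P.exists_norm_integral_regularize_le s t hs ht
  obtain ⟨B₂, hB₂, h₂⟩ := P.exists_norm_integral_commutator_le hD s t hs ht d hd hL hdt hds
  -- The formal adjoint exchanges `s` and `t` and reflects the kernel.
  refine ⟨fun m => P.regularize (η.scale m) s t hs, ⟨fun m =>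
    P.regularize (η.scale m).reflect t s ht, fun m => P.integral_inner_regularize_eq _ s t hs ht⟩,
    ⟨2 * (B₁ * c₀), fun m ψ => norm_le_of_norm_inner_le fun φ => ?_⟩, fun m => ?_,
    ⟨2 * (B₂ * (c₀ + ∑ j, c₁ j)), fun m ψ => norm_le_of_norm_inner_le fun φ => ?_⟩, fun ψ => ?_⟩
  · rw [preL2_norm_sq, preL2_norm_sq]
    exact h₁ (η.scale m) c₀ hc₀ ((η.lintegral_enorm_scale m).trans_le hηc) φ ψ
  · obtain ⟨B, -, hB⟩ := P.exists_norm_integral_onTestSections_regularize_le D s t hs ht (η.scale m)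
    refine ⟨2 * B, fun ψ => norm_le_of_norm_inner_le fun φ => ?_⟩
    rw [preL2_norm_sq, preL2_norm_sq]
    exact hB φ ψ
  · rw [preL2_norm_sq, preL2_norm_sq]
    exact h₂ (η.scale m) _ (by positivity)
      (((η.lintegral_enorm_scale m).trans_le hηc).trans (ENNReal.ofReal_le_ofReal (by linarith)))
      (fun j => ((η.lintegral_enorm_pderiv_scale m j).trans_le (hηc₁ j)).trans
        (ENNReal.ofReal_le_ofReal (hle j))) φ ψ
  · refine tendsto_iff_norm_sub_tendsto_zero.2 ?_
    have h := (P.tendsto_normSq_regularize hη s t hs ht ρ ψ (hρ ψ)).sqrt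
    rw [Real.sqrt_zero] at h
    refine h.congr fun m => ?_
    rw [← Real.sqrt_sq (norm_nonneg _), preL2_norm_sq]
    rfl

variable [FiniteDimensional ℂ F] [ContMDiffVectorBundle ∞ F S (𝓡 n)]

/-- With dual frames `T`, `Θ` near the support of `ρ`, take `s a = ρ Θ a` and `t a = θ T a`, where
`θ` is a cut-off divided by the density. Commutators have order zero, so the factors `ρ` and `θ` do
not change the coefficient matrix `d`. -/
theorem DifferentialOperator.exists_isRegularizing_of_tsupport_subset
    {D : DifferentialOperator n F S} (hD : D.IsFormallySymmetric μ) (x₀ : M)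
    (ρ : C^∞⟮𝓡 n, M; 𝓘(ℝ, ℝ), ℝ⟯) (hρc : HasCompactSupport ρ)
    (hρs : tsupport ρ ⊆ (chartAt (EuclideanSpace ℝ (Fin n)) x₀).source ∩
      (trivializationAt F S x₀).baseSet) :
    ∃ J, IsRegularizing (V := PreL2 n F S μ) D.onTestSections J (mulTest (complexify ρ)) := by
  set φ := chartAt (EuclideanSpace ℝ (Fin n)) x₀ with hφ
  set e := trivializationAt F S x₀
  have hU : IsOpen (φ.source ∩ e.baseSet) := φ.open_source.inter e.open_baseSet
  obtain ⟨χ, hχ1, hχc, hχU⟩ := exists_contMDiffMap_eq_one (n := n) hρc.isCompact hU hρs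
  have hχφ : tsupport χ ⊆ φ.source := hχU.trans inter_subset_left
  obtain ⟨T, Θ, hΘU, hT, hΘ⟩ := exists_dual_frames (n := n) e hχc.isCompact hU hχU inter_subset_right
  obtain ⟨P, hPK, hPξ, hPd, hPpos⟩ := exists_patch μ x₀ hχc.isCompact hχφ
  -- Dividing by the density compensates for the factor `dens` in the limit of the mollifications.
  let θ : C^∞⟮𝓡 n, M; 𝓘(ℝ, ℝ), ℝ⟯ := ⟨fun x => χ x • (P.dens x)⁻¹,
    contMDiff_smul_of_tsupport_subset χ.contMDiff φ.open_source hχφ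
      (hPd.inv₀ fun x hx => (hPpos x hx).ne')⟩
  have hθ0 : ∀ x ∉ P.K, θ x = 0 := fun x hx => by
    change χ x • (P.dens x)⁻¹ = 0
    rw [hPK] at hx
    rw [image_eq_zero_of_notMem_tsupport hx, zero_smul]
  have hρ0 : ∀ x ∉ P.K, ρ x = 0 := fun x hx => by
    refine image_eq_zero_of_notMem_tsupport fun h => hx ?_
    rw [hPK]
    exact subset_tsupport _ (by simp [hχ1 x h])
  let d : Fin n → Fin (Module.finrank ℂ F) → Fin (Module.finrank ℂ F) → M → ℂ := fun j a b x =>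
    inner ℂ ((Θ b).1 x) ((D.commTest (coordFn P.ξ j) (T a)).1 x)
  have hdc : ∀ j a b, ContMDiff (𝓡 n) 𝓘(ℝ, ℂ) ∞ (d j a b) := fun j a b =>
    IsSmoothHermitian.contMDiff_inner (n := n) (F := F) _ (Θ b).2.1 _
      (D.commTest (coordFn P.ξ j) (T a)).2.1
  -- The coefficient `d` inherits compact support in the chart domain from `Θ b`.
  have hdL : ∀ j a b, ∃ L : NNReal, ∀ x ∈ φ.source, ∀ y ∈ φ.source,
      ‖d j a b x - d j a b y‖ ≤ L * ‖φ x - φ y‖ := fun j a b =>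
    exists_lipschitz_chart x₀ (hdc j a b) (hasCompactSupport_inner_left (Θ b) _)
      ((closure_mono fun x (hx : d j a b x ≠ 0) (h0 : (Θ b).1 x = 0) =>
        hx (by simp [d, h0])).trans ((hΘU b).trans inter_subset_left))
  choose L hL using hdL
  refine D.isRegularizing hD P (fun a => mulTest (complexify ρ) (Θ a))
    (fun a => mulTest (complexify θ) (T a)) (fun a x hx => by simp [hρ0 x hx])
    (fun a x hx => by simp [hθ0 x hx]) d (fun j a b => (hdc j a b).continuous)
    (L := ∑ j, ∑ a, ∑ b, L j a b) (fun j a b x hx y hy => ?_) (fun j a x => ?_) (fun j a x => ?_)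
    _ fun ψ x => ?_
  · rw [hPξ x (hPK ▸ hx), hPξ y (hPK ▸ hy)]
    refine (hL j a b x (hχφ (hPK ▸ hx)) y (hχφ (hPK ▸ hy))).trans ?_
    gcongr
    exact (Finset.single_le_sum_of_canonicallyOrdered (f := fun b => L j a b)
      (Finset.mem_univ b)).trans
      ((Finset.single_le_sum_of_canonicallyOrdered (f := fun a => ∑ b, L j a b)
        (Finset.mem_univ a)).trans
        (Finset.single_le_sum_of_canonicallyOrdered (f := fun j => ∑ a, ∑ b, L j a b)
          (Finset.mem_univ j)))
  · have h1 : (D.commTest (coordFn P.ξ j) (mulTest (complexify θ) (T a))).1 x =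
        complexify θ x • (D.commTest (coordFn P.ξ j) (T a)).1 x :=
      D.comm_mulSection _ _ (toSmooth (T a)) x
    rw [h1]
    by_cases hx : x ∈ P.K
    · conv_lhs => rw [← hT x (hPK ▸ hx) ((D.commTest (coordFn P.ξ j) (T a)).1 x)]
      simp only [Finset.smul_sum, mulTest_apply]
      exact Finset.sum_congr rfl fun b _ => smul_comm _ _ _
    · simp [hθ0 x hx]
  · have h1 : (D.commTest (coordFn P.ξ j) (mulTest (complexify ρ) (Θ a))).1 x =
        complexify ρ x • (D.commTest (coordFn P.ξ j) (Θ a)).1 x :=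
      D.comm_mulSection _ _ (toSmooth (Θ a)) x
    -- The skew-Hermitian symbol ties the matrix in the dual frame to the one in the frame. This is
    -- what lets the singular terms combine.
    have h2 : ∀ b, inner ℂ ((T b).1 x) ((D.commTest (coordFn P.ξ j) (Θ a)).1 x) =
        -conj (d j b a x) := fun b => by
      rw [inner_conj_symm, D.inner_commTest hD (fun p => Complex.conj_ofReal _), neg_neg]
    rw [h1]
    by_cases hx : x ∈ P.K
    · conv_lhs => rw [← hΘ x (hPK ▸ hx) ((D.commTest (coordFn P.ξ j) (Θ a)).1 x)]
      simp only [Finset.smul_sum, mulTest_apply, h2, neg_smul, smul_neg, Finset.sum_neg_distrib]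
      exact congrArg Neg.neg (Finset.sum_congr rfl fun b _ => smul_comm _ _ _)
    · simp [hρ0 x hx]
  · by_cases hx : x ∈ tsupport ρ
    · have hxφ : x ∈ φ.source := (hρs hx).1
      have hxK : x ∈ tsupport χ := subset_tsupport _ (by simp [hχ1 x hx])
      have h1 : (P.dens x : ℂ) * θ x = 1 := by
        have : θ x = (P.dens x)⁻¹ := by
          change χ x • (P.dens x)⁻¹ = _
          rw [hχ1 x hx, one_smul]
        rw [this, ← Complex.ofReal_mul, mul_inv_cancel₀ (hPpos x hxφ).ne', Complex.ofReal_one]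
      conv_rhs => rw [← hT x hxK (ψ.1 x)]
      rw [Finset.smul_sum]
      refine Finset.sum_congr rfl fun a _ => ?_
      rw [mulTest_apply, mulTest_apply, inner_smul_left, complexify_apply, complexify_apply,
        Complex.conj_ofReal, smul_smul, smul_smul, Complex.real_smul]
      congr 1
      linear_combination (ρ x * inner ℂ ((Θ a).1 x) (ψ.1 x)) * h1
    · simp [image_eq_zero_of_notMem_tsupport hx]

end LocalRegularizing

/-! ### The closure and the adjoint of a symmetric differential operator -/

section Adjoint

open Filter

/-- The adjoint is closed and extends `T`, and the closure is the smallest closed extension. -/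
theorem isSymmetricOp_closure_le_adjoint {H : Type*} [NormedAddCommGroup H] [InnerProductSpace ℂ H]
    [CompleteSpace H] {T : H →ₗ.[ℂ] H} (hT : IsSymmetricOp T) (hd : Dense (T.domain : Set H)) :
    T.closure ≤ T† := by
  have hle : T ≤ T† := LinearPMap.IsFormalAdjoint.le_adjoint hd hT
  refine LinearPMap.le_of_le_graph ?_
  rw [← (hT.isClosable hd).graph_closure_eq_closure_graph]
  exact Submodule.topologicalClosure_minimal _ (LinearPMap.le_graph_of_le hle)
    (LinearPMap.adjoint_isClosed hd)

variable {n : ℕ} {M : Type*} [TopologicalSpace M] [ChartedSpace (EuclideanSpace ℝ (Fin n)) M]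
  [IsManifold (𝓡 n) ∞ M]

theorem exists_finite_partition_of_unity [T2Space M] [SecondCountableTopology M] {K : Set M} (hK : IsCompact K) {U : M → Set M}
    (hU : ∀ x, IsOpen (U x)) (hxU : ∀ x, x ∈ U x) :
    ∃ (t : Finset M) (ρ : t → C^∞⟮𝓡 n, M; 𝓘(ℝ, ℝ), ℝ⟯),
      (∀ i, HasCompactSupport (ρ i)) ∧ (∀ i, tsupport (ρ i) ⊆ U i) ∧
      ∀ x ∈ K, ∑ i, ρ i x = 1 := by
  have : LocallyCompactSpace M := ChartedSpace.locallyCompactSpace (EuclideanSpace ℝ (Fin n)) M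
  obtain ⟨t, ht⟩ := hK.elim_finite_subcover U hU fun x _ => mem_iUnion.2 ⟨x, hxU x⟩
  obtain ⟨f, hf⟩ := SmoothPartitionOfUnity.exists_isSubordinate (𝓡 n) hK.isClosed
    (fun i : t => U i) (fun i => hU i) (by simpa [iUnion_subtype] using ht)
  -- A subordinate partition of unity need not have compact supports. Multiplying by `χ` makes them
  -- compact without changing the sum on `K`.
  obtain ⟨χ, hχ1, hχc, -⟩ := exists_contMDiffMap_eq_one (n := n) hK isOpen_univ (subset_univ K)
  refine ⟨t, fun i => χ * f i, fun i => hχc.mul_right,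
    fun i => (tsupport_mul_subset_right).trans (hf i), fun x hx => ?_⟩
  have h := f.sum_eq_one hx
  rw [finsum_eq_sum_of_fintype] at h
  simp only [ContMDiffMap.coe_mul, Pi.mul_apply, hχ1 x hx, one_mul, h]

variable [MeasurableSpace M] [BorelSpace M] {μ : Measure M} [IsSmoothMeasure n μ]
  {F : Type*} [NormedAddCommGroup F] [NormedSpace ℂ F]
  {S : M → Type*} [TopologicalSpace (TotalSpace F S)]
  [∀ p, NormedAddCommGroup (S p)] [∀ p, InnerProductSpace ℂ (S p)]
  [FiberBundle F S] [VectorBundle ℂ F S] [IsSmoothHermitian n F S]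

theorem DifferentialOperator.isFormallySymmetric {D : DifferentialOperator n F S}
    (hD : IsSymmetricOp (D.toLinearPMap μ)) : D.IsFormallySymmetric μ := fun u v => by
  have h := hD ⟨toL2 n F S μ u, u, rfl⟩ ⟨toL2 n F S μ v, v, rfl⟩
  rw [D.toLinearPMap_apply, D.toLinearPMap_apply] at h
  exact (UniformSpace.Completion.inner_coe (𝕜 := ℂ) (E := PreL2 n F S μ) _ _).symm.trans
    (h.trans (UniformSpace.Completion.inner_coe (𝕜 := ℂ) (E := PreL2 n F S μ) _ _))

theorem L2.isCompactlySupported [CompactSpace M] (u : L2 n F S μ) : u.IsCompactlySupported := by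
  refine ⟨univ, isCompact_univ, ?_⟩
  have h := (UniformSpace.Completion.denseRange_coe (α := PreL2 n F S μ)) u
  refine closure_mono ?_ h
  rintro _ ⟨w, rfl⟩
  exact ⟨w, subset_univ _, rfl⟩

variable [T2Space M] [SecondCountableTopology M] [FiniteDimensional ℂ F]
  [ContMDiffVectorBundle ∞ F S (𝓡 n)]

/-- The local sequences tend to multiplication by the `ρ i`. Their sum tends to multiplication by `∑
i, ρ i`, which is the identity on sections supported in `K`. -/
theorem DifferentialOperator.exists_isRegularizing {D : DifferentialOperator n F S}
    (hD : D.IsFormallySymmetric μ) {K : Set M} (hK : IsCompact K) :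
    ∃ J A, IsRegularizing (V := PreL2 n F S μ) D.onTestSections J A ∧
      ∀ w : testSections n F S, sectionSupport w.1 ⊆ K → A w = w := by
  obtain ⟨t, ρ, hρc, hρs, hρ1⟩ := exists_finite_partition_of_unity (n := n) hK
    (U := fun x => (chartAt (EuclideanSpace ℝ (Fin n)) x).source ∩
      (trivializationAt F S x).baseSet)
    (fun x => (chartAt _ x).open_source.inter (trivializationAt F S x).open_baseSet)
    fun x => ⟨mem_chart_source _ x, mem_baseSet_trivializationAt F S x⟩
  choose J hJ using fun i : t =>
    D.exists_isRegularizing_of_tsupport_subset hD i (ρ i) (hρc i) (hρs i)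
  refine ⟨_, _, IsRegularizing.sum hJ, fun w hw => Subtype.ext (funext fun x => ?_)⟩
  refine (coe_sum_testSections Finset.univ (fun i => mulTest (complexify (ρ i)) w) x).trans ?_
  simp only [mulTest_apply, complexify_apply, ← Finset.sum_smul, ← Complex.ofReal_sum]
  by_cases hx : x ∈ K
  · rw [hρ1 x hx, Complex.ofReal_one, one_smul]
  · rw [by_contra fun h => hx (hw (subset_closure h)), smul_zero]

theorem DifferentialOperator.mem_domain_closure_of_mem_domain_adjoint
    {D : DifferentialOperator n F S} (hD : IsSymmetricOp (D.toLinearPMap μ)) {u : L2 n F S μ}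
    (hu : u.IsCompactlySupported) (hu' : u ∈ (D.toLinearPMap μ)†.domain) :
    u ∈ (D.toLinearPMap μ).closure.domain := by
  obtain ⟨K, hK, huK⟩ := hu
  have hDs := D.isFormallySymmetric hD
  obtain ⟨J, A, hJ, hA⟩ := D.exists_isRegularizing hDs hK
  obtain ⟨J', hJ'⟩ := hJ.exists_adjoint
  obtain ⟨C₁, hC₁⟩ := hJ.exists_bound
  obtain ⟨C₂, hC₂⟩ := hJ.exists_bound_commutator
  refine mem_closure_domain_of_regularizers (T := D.toLinearPMap μ)
    (UniformSpace.Completion.toComplₗᵢ (𝕜 := ℂ) (E := PreL2 n F S μ))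
    (UniformSpace.Completion.denseRange_coe (α := PreL2 n F S μ)) D.onTestSections hDs
    D.dense_domain (hD.isClosable D.dense_domain) (fun x => ?_) J J' hJ' (C := max C₁ C₂)
    (fun m x => (hC₁ m x).trans (by gcongr; exact le_max_left _ _)) hJ.exists_bound_comp
    (fun m x => (hC₂ m x).trans (by gcongr; exact le_max_right _ _))
    (W := {w : testSections n F S | sectionSupport w.1 ⊆ K}) (fun w hw => ?_) huK hu'
  · exact (D.toLinearPMap μ).mem_graph_iff.2
      ⟨⟨toL2 n F S μ x, x, rfl⟩, rfl, D.toLinearPMap_apply x⟩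
  · have h := hJ.tendsto w
    rwa [hA w hw] at h

end Adjoint

end HermitianL2

end

theorem mainTheorem4 (n : ℕ)
    {M : Type*} [TopologicalSpace M] [T2Space M] [SecondCountableTopology M]
    [ChartedSpace (EuclideanSpace ℝ (Fin n)) M] [IsManifold (𝓡 n) ∞ M]
    [MeasurableSpace M] [BorelSpace M]
    {F : Type*} [NormedAddCommGroup F] [NormedSpace ℂ F] [FiniteDimensional ℂ F]
    {S : M → Type*} [TopologicalSpace (TotalSpace F S)]
    [∀ p, NormedAddCommGroup (S p)] [∀ p, InnerProductSpace ℂ (S p)]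
    [FiberBundle F S] [VectorBundle ℂ F S] [ContMDiffVectorBundle ∞ F S (𝓡 n)]
    [HermitianL2.IsSmoothHermitian n F S]
    (μ : Measure M) [HermitianL2.IsSmoothMeasure n μ]
    (D : HermitianL2.DifferentialOperator n F S)
    (hD : HermitianL2.IsSymmetricOp (D.toLinearPMap μ)) :
    (∀ u : HermitianL2.L2 n F S μ, u.IsCompactlySupported →
      (u ∈ (D.toLinearPMap μ).closure.domain ↔ u ∈ (D.toLinearPMap μ)†.domain)) ∧
    (CompactSpace M → HermitianL2.IsEssentiallySelfAdjointOp (D.toLinearPMap μ)) := by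

  have key : ∀ u : HermitianL2.L2 n F S μ, u.IsCompactlySupported →
      (u ∈ (D.toLinearPMap μ).closure.domain ↔ u ∈ (D.toLinearPMap μ)†.domain) := fun u hu =>
    ⟨fun h => (HermitianL2.isSymmetricOp_closure_le_adjoint hD D.dense_domain).1 h,
      D.mem_domain_closure_of_mem_domain_adjoint hD hu⟩
  -- On a compact manifold every element is compactly supported, with `K` the whole of `M`.
  exact ⟨key, fun _ => ⟨hD, Submodule.ext fun u => key u u.isCompactlySupported⟩⟩
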